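/- Let $d\ge 2$, let $\sigma$ be the spherical Lebesgue measure on the unit sphere $\mathbb S^d\subset\mathbb R^{d+1}$, and put $\omega_k=2\pi^{k/2}/\Gamma(k/2)$ (so that $\sigma(\mathbb S^d)=\omega_{d+1}$) and $\kappa_k=\omega_k/k$. Fix $e\in\mathbb S^d$, let $\mathbb S_e^+=\{u\in\mathbb S^d:\langle u,e\rangle\ge 0\}$ be the closed halfsphere with pole $e$, and let $\mu=\frac{2}{\omega_{d+1}}\,\sigma|_{\mathbb S_e^+}$ be the uniform probability measure on it. For $n\ge d+1$ let $X_1,\dots,X_n$ be independent random points with distribution $\mu$, and let $P_n=\mathbb S^d\cap \operatorname{pos}\{X_1,\dots,X_n\}$ be their spherical convex hull, where $\operatorname{pos}$ denotes the positive hull in $\mathbb R^{d+1}$. Let $f_{d-1}(P_n)$ be the number of facets of $P_n$, that is, of the sets $F\cap\mathbb S^d$ with $F$ a $d$-dimensional face of the cone $\operatorname{pos}P_n$. Then, for every $n\ge d+1$, the random variable $f_{d-1}(P_n)$ is integrable and $$\mathbb E\, f_{d-1}(P_n)=\frac{2\omega_d}{\omega_{d+1}}\binom nd\int_0^\pi\left(1-\frac{\alpha}{\pi}\right)^{n-d}\sin^{d-1}\alpha\,\mathrm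 d\alpha .$$ Further, $$\lim_{n\to\infty}\mathbb E\, f_{d-1}(P_n)=2^{-d}\,d!\,\kappa_d^2 .$$ -/

import Mathlib

open MeasureTheory ProbabilityTheory

noncomputable section

namespace HalfspherePolytope

/-- The Euclidean space `ℝ^(d+1)`. -/
abbrev Space (d : ℕ) : Type := EuclideanSpace ℝ (Fin (d + 1))

/-- The unit sphere `S^d` of `ℝ^(d+1)`. -/
abbrev UnitSphere (d : ℕ) : Type := Metric.sphere (0 : Space d) 1

/-- `ω k = 2 π^(k/2) / Γ(k/2)`, the surface area of the unit sphere of `ℝ^k` (for `k ≥ 1`). -/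
def omega (k : ℕ) : ℝ := 2 * Real.pi ^ ((k : ℝ) / 2) / Real.Gamma ((k : ℝ) / 2)

/-- `κ k = ω k / k`, the volume of the unit ball of `ℝ^k` (for `k ≥ 1`). -/
def kappa (k : ℕ) : ℝ := omega k / k

/-- The spherical Lebesgue measure `σ` on `S^d`. -/
def sphereMeasure (d : ℕ) : Measure (UnitSphere d) := (volume : Measure (Space d)).toSphere

/-- The closed halfsphere with pole `e`. -/
def halfsphere {d : ℕ} (e : UnitSphere d) : Set (UnitSphere d) :=
  {u | 0 ≤ inner ℝ (u : Space d) (e : Space d)}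

/-- The uniform distribution on the closed halfsphere with pole `e`: the restriction of `σ` to the
halfsphere, multiplied by `2 / ω (d+1)`. -/
def uniformHalfsphere {d : ℕ} (e : UnitSphere d) : Measure (UnitSphere d) :=
  ENNReal.ofReal (2 / omega (d + 1)) • (sphereMeasure d).restrict (halfsphere e)

/-- The positive hull in `ℝ^(d+1)` of a subset of the sphere. -/
def pos {d : ℕ} (A : Set (UnitSphere d)) : PointedCone ℝ (Space d) :=
  PointedCone.hull ℝ ((fun u : UnitSphere d => (u : Space d)) '' A)

/-- The spherical convex hull: the intersection of the sphere with the positive hull. -/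
def convS {d : ℕ} (A : Set (UnitSphere d)) : Set (UnitSphere d) :=
  {u | (u : Space d) ∈ pos A}

/-- The `k`-dimensional faces of a spherical polytope `P`: the intersections with the sphere of
those faces of the cone spanned by `P` that have linear dimension `k + 1`. -/
def faces {d : ℕ} (k : ℕ) (P : Set (UnitSphere d)) : Set (Set (UnitSphere d)) :=
  {G | ∃ F : PointedCone ℝ (Space d), F.IsFaceOf (pos P) ∧
    Module.finrank ℝ (Submodule.span ℝ (F : Set (Space d))) = k + 1 ∧
    G = {u : UnitSphere d | (u : Space d) ∈ F}}

/-- The number of `k`-dimensional faces of a spherical polytope. -/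
def faceNumber {d : ℕ} (k : ℕ) (P : Set (UnitSphere d)) : ℕ := (faces k P).ncard

/-- The random variables `X i` are independent uniform random points of the closed halfsphere with
pole `e`, on a space with measure `Q`. -/
structure IsUniformSample {d : ℕ} (e : UnitSphere d) {Ω : Type*} [MeasurableSpace Ω]
    (Q : Measure Ω) {n : ℕ} (X : Fin n → Ω → UnitSphere d) : Prop where
  indep : iIndepFun X Q
  law : ∀ i, HasLaw (X i) (uniformHalfsphere e) Q

/-- The random spherical polytope `P_n`, the spherical convex hull of the random points. -/
def randomPolytope {d n : ℕ} {Ω : Type*} (X : Fin n → Ω → UnitSphere d) (ω : Ω) :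
    Set (UnitSphere d) :=
  convS (Set.range fun i => X i ω)

end HalfspherePolytope

end

/-!
Almost surely any `d + 1` of the points are linearly independent, so that the facets of the cone are
spanned by the `d`-element subsets of the sample whose linear span has all the other points strictly
on one side. A halfspace whose normal makes the angle `α` with the pole meets the halfsphere in a
lune of probability `1 - α / π`; hence, given `d` points, the other `n - d` lie on one side of their
hyperplane with probability `(1 - α / π) ^ (n - d) + (α / π) ^ (n - d)`. The hyperplane does not
change when a point is replaced by its antipode, so the `d` points may be taken uniform on the whole
sphere. By rotation invariance their normal vector then has a uniform direction, and `α` has density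
proportional to `sin α ^ (d - 1)`. Measures on the sphere are computed by integrating homogeneous
functions of degree zero against `exp (-‖x‖)`.

For the limit, `α * (1 - α / π) ^ 2 ≤ sin α ≤ α` squeezes the integral between two Beta integrals.
-/

noncomputable section

namespace HalfspherePolytope

open Metric Set Filter InnerProductGeometry Module
open scoped RealInnerProductSpace ENNReal Topology

section Polar

variable {E : Type*} [NormedAddCommGroup E] [NormedSpace ℝ E] [MeasurableSpace E] [BorelSpace E]
  [FiniteDimensional ℝ E] [Nontrivial E] (μ : Measure E) [μ.IsAddHaarMeasure]

theorem lintegral_eq_lintegral_toSphere {F : E → ℝ≥0∞} (hF : Measurable F) :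
    ∫⁻ x, F x ∂μ = ∫⁻ u : sphere (0 : E) 1, (∫⁻ r in Ioi (0 : ℝ),
      ENNReal.ofReal (r ^ (finrank ℝ E - 1)) * F (r • (u : E))) ∂μ.toSphere := by
  have hG : Measurable fun p : sphere (0 : E) 1 × Ioi (0 : ℝ) => F ((p.2 : ℝ) • (p.1 : E)) := by
    fun_prop
  calc
    ∫⁻ x, F x ∂μ = ∫⁻ x : ({(0)}ᶜ : Set E), F x ∂(μ.comap (↑)) := by
      rw [lintegral_subtype_comap (measurableSet_singleton _).compl F, restrict_compl_singleton]
    _ = ∫⁻ p, F ((p.2 : ℝ) • (p.1 : E)) ∂μ.toSphere.prod (.volumeIoiPow (finrank ℝ E - 1)) := by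
      rw [← μ.measurePreserving_homeomorphUnitSphereProd.lintegral_comp hG]
      refine lintegral_congr fun x => ?_
      rw [← homeomorphUnitSphereProd_symm_apply_coe, Homeomorph.symm_apply_apply]
    _ = _ := by
      rw [lintegral_prod _ hG.aemeasurable]
      refine lintegral_congr fun u => ?_
      rw [Measure.volumeIoiPow,
        lintegral_withDensity_eq_lintegral_mul _ (by fun_prop) (by fun_prop)]
      exact lintegral_subtype_comap measurableSet_Ioi
        fun r : ℝ => ENNReal.ofReal (r ^ (finrank ℝ E - 1)) * F (r • (u : E))

theorem lintegral_mul_fun_norm {g : E → ℝ≥0∞} (hg : Measurable g)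
    (hom : ∀ (r : ℝ) (x : E), 0 < r → g (r • x) = g x) {φ : ℝ → ℝ≥0∞} (hφ : Measurable φ) :
    ∫⁻ x, g x * φ ‖x‖ ∂μ = (∫⁻ u : sphere (0 : E) 1, g u ∂μ.toSphere) *
      ∫⁻ r in Ioi (0 : ℝ), ENNReal.ofReal (r ^ (finrank ℝ E - 1)) * φ r := by
  rw [lintegral_eq_lintegral_toSphere μ (by fun_prop), ← lintegral_mul_const _ (by fun_prop)]
  refine lintegral_congr fun u => ?_
  rw [← lintegral_const_mul _ (by fun_prop)]
  refine setLIntegral_congr_fun measurableSet_Ioi fun r (hr : 0 < r) => ?_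
  simp only [hom r u hr, norm_smul, Real.norm_of_nonneg hr.le, norm_eq_of_mem_sphere, mul_one]
  exact mul_left_comm _ _ _

theorem lintegral_fun_norm {φ : ℝ → ℝ≥0∞} (hφ : Measurable φ) :
    ∫⁻ x, φ ‖x‖ ∂μ = μ.toSphere univ *
      ∫⁻ r in Ioi (0 : ℝ), ENNReal.ofReal (r ^ (finrank ℝ E - 1)) * φ r := by
  simpa using lintegral_mul_fun_norm μ (g := 1) measurable_one (fun _ _ _ => rfl) hφ

theorem lintegral_pow_mul_exp_neg (n : ℕ) :
    ∫⁻ r in Ioi (0 : ℝ), ENNReal.ofReal (r ^ n) * ENNReal.ofReal (Real.exp (-r)) = n.factorial := by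
  have hcongr : ∀ r ∈ Ioi (0 : ℝ), ENNReal.ofReal (r ^ n) * ENNReal.ofReal (Real.exp (-r)) =
      ENNReal.ofReal (Real.exp (-r) * r ^ ((n + 1 : ℝ) - 1)) := fun r (hr : 0 < r) => by
    rw [← ENNReal.ofReal_mul (by positivity), add_sub_cancel_right, Real.rpow_natCast, mul_comm]
  rw [setLIntegral_congr_fun measurableSet_Ioi hcongr,
    ← ofReal_integral_eq_lintegral_ofReal (Real.GammaIntegral_convergent (by positivity)),
    ← Real.Gamma_eq_integral (by positivity), Real.Gamma_nat_eq_factorial, ENNReal.ofReal_natCast]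
  filter_upwards [ae_restrict_mem measurableSet_Ioi] with r hr
  have : (0 : ℝ) < r := hr
  positivity

theorem lintegral_mul_exp_neg_norm {g : E → ℝ≥0∞} (hg : Measurable g)
    (hom : ∀ (r : ℝ) (x : E), 0 < r → g (r • x) = g x) :
    ∫⁻ x, g x * ENNReal.ofReal (Real.exp (-‖x‖)) ∂μ =
      (∫⁻ u : sphere (0 : E) 1, g u ∂μ.toSphere) * (finrank ℝ E - 1).factorial := by
  rw [← lintegral_pow_mul_exp_neg]
  exact lintegral_mul_fun_norm μ hg hom (φ := fun r => ENNReal.ofReal (Real.exp (-r)))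
    (by fun_prop)

end Polar

theorem omega_pos {k : ℕ} (hk : 0 < k) : 0 < omega k := by
  have : 0 < Real.Gamma ((k : ℝ) / 2) := Real.Gamma_pos_of_pos (by positivity)
  unfold omega
  positivity

section Projection

variable {E K : Type*} [NormedAddCommGroup E] [InnerProductSpace ℝ E]
  [NormedAddCommGroup K] [InnerProductSpace ℝ K]

theorem norm_map_add_orthogonal (i : K →ₗᵢ[ℝ] E) (y : K) (z : (i.range)ᗮ) :
    ‖i y + (z : E)‖ = √(‖y‖ ^ 2 + ‖z‖ ^ 2) := by
  have hz : ⟪i y, (z : E)⟫ = 0 := z.2 _ ⟨y, rfl⟩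
  rw [← Real.sqrt_sq (norm_nonneg (i y + (z : E))), norm_add_sq_real, hz, i.norm_map,
    mul_zero, add_zero, Submodule.coe_norm]

variable [FiniteDimensional ℝ E] [FiniteDimensional ℝ K]

theorem adjoint_map_add_orthogonal (i : K →ₗᵢ[ℝ] E) (y : K) (z : (i.range)ᗮ) :
    i.toContinuousLinearMap.adjoint (i y + z) = y := by
  refine ext_inner_left ℝ fun v => ?_
  have hz : ⟪i v, (z : E)⟫ = 0 := z.2 _ ⟨v, rfl⟩
  rw [ContinuousLinearMap.adjoint_inner_right, inner_add_right,
    LinearIsometry.coe_toContinuousLinearMap, i.inner_map_map, hz, add_zero]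

variable [MeasurableSpace E] [BorelSpace E]

theorem toSphere_univ_eq_omega [Nontrivial E] :
    (volume : Measure E).toSphere univ = ENNReal.ofReal (omega (finrank ℝ E)) := by
  have hk : (0 : ℝ) < finrank ℝ E := by exact_mod_cast finrank_pos
  rw [Measure.toSphere_apply_univ, InnerProductSpace.volume_ball, ENNReal.ofReal_one, one_pow,
    one_mul, ← ENNReal.ofReal_natCast, ← ENNReal.ofReal_mul (by positivity)]
  congr 1
  rw [Real.Gamma_add_one (by positivity), omega, Real.sqrt_eq_rpow, ← Real.rpow_natCast,
    ← Real.rpow_mul Real.pi_pos.le]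
  field_simp

variable [MeasurableSpace K] [BorelSpace K]

theorem lintegral_eq_lintegral_orthogonal (i : K →ₗᵢ[ℝ] E) {F : E → ℝ≥0∞} (hF : Measurable F) :
    ∫⁻ x, F x = ∫⁻ y : K, ∫⁻ z : (i.range)ᗮ, F (i y + z) := by
  have hsplit : MeasurePreserving fun p : K × (i.range)ᗮ => i p.1 + (p.2 : E) :=
    (i.range.orthogonalDecomposition.symm.measurePreserving.comp
      (WithLp.volume_preserving_toLp i.range (i.range)ᗮ)).comp
      (i.equivRange.measurePreserving.prod (.id volume))
  rw [← hsplit.lintegral_comp hF, Measure.volume_eq_prod,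
    lintegral_prod (fun p : K × (i.range)ᗮ => F (i p.1 + p.2))
      (hF.comp hsplit.measurable).aemeasurable]

-- Both sides come from the integral of `h (i† x) * exp (-‖x‖)` over `E`: its `K`-part is radial
-- apart from `h`.
theorem lintegral_toSphere_adjoint [Nontrivial E] [Nontrivial K] (i : K →ₗᵢ[ℝ] E)
    {h : K → ℝ≥0∞} (hh : Measurable h) (hom : ∀ (r : ℝ) (y : K), 0 < r → h (r • y) = h y) :
    (∫⁻ u : sphere (0 : E) 1, h (i.toContinuousLinearMap.adjoint u)
        ∂(volume : Measure E).toSphere) * (volume : Measure K).toSphere univ =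
      (∫⁻ v : sphere (0 : K) 1, h v ∂(volume : Measure K).toSphere) *
        (volume : Measure E).toSphere univ := by
  let φ : ℝ → ℝ≥0∞ := fun ρ =>
    ∫⁻ z : (i.range)ᗮ, ENNReal.ofReal (Real.exp (-√(ρ ^ 2 + ‖z‖ ^ 2)))
  have hφ : Measurable φ := Measurable.lintegral_prod_right'
    (f := fun p : ℝ × (i.range)ᗮ => ENNReal.ofReal (Real.exp (-√(p.1 ^ 2 + ‖p.2‖ ^ 2))))
    (by fun_prop)
  obtain ⟨c, hc⟩ : ∃ c : ℝ≥0∞, ∀ g : K → ℝ≥0∞, Measurable g →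
      (∀ (r : ℝ) (y : K), 0 < r → g (r • y) = g y) →
      (∫⁻ u : sphere (0 : E) 1, g (i.toContinuousLinearMap.adjoint u)
        ∂(volume : Measure E).toSphere) * (finrank ℝ E - 1).factorial =
      (∫⁻ v : sphere (0 : K) 1, g v ∂(volume : Measure K).toSphere) * c := by
    refine ⟨∫⁻ r in Ioi (0 : ℝ), ENNReal.ofReal (r ^ (finrank ℝ K - 1)) * φ r,
      fun g hg hom => ?_⟩
    rw [← lintegral_mul_exp_neg_norm volume (g := fun x => g (i.toContinuousLinearMap.adjoint x))
        (by fun_prop) (fun r x hr => by rw [map_smul, hom _ _ hr]),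
      lintegral_eq_lintegral_orthogonal i (by fun_prop),
      ← lintegral_mul_fun_norm volume hg hom hφ]
    refine lintegral_congr fun y => ?_
    simp_rw [adjoint_map_add_orthogonal, norm_map_add_orthogonal]
    exact lintegral_const_mul _ (by fun_prop)
  have hone := hc 1 measurable_one fun _ _ _ => rfl
  simp only [Pi.one_apply, lintegral_one] at hone
  have hfac : ((finrank ℝ E - 1).factorial : ℝ≥0∞) ≠ 0 := by
    exact_mod_cast Nat.factorial_ne_zero _
  rw [← ENNReal.mul_left_inj hfac (by finiteness), mul_right_comm, hc h hh hom, mul_assoc,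
    mul_assoc, hone, mul_comm c]

end Projection

section Lune

theorem lintegral_toSphere_complex {h : ℂ → ℝ≥0∞} (hh : Measurable h)
    (hom : ∀ (r : ℝ) (z : ℂ), 0 < r → h (r • z) = h z) :
    ∫⁻ v : sphere (0 : ℂ) 1, h v ∂(volume : Measure ℂ).toSphere =
      ∫⁻ θ in Ioo (-Real.pi) Real.pi, h (Complex.exp (θ * Complex.I)) := by
  have hexp := lintegral_mul_exp_neg_norm volume hh hom
  rw [Complex.finrank_real_complex, Nat.factorial_one, Nat.cast_one, mul_one] at hexp
  have hpolar : ∀ p ∈ polarCoord.target,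
      ENNReal.ofReal p.1 • (h (Complex.polarCoord.symm p) *
        ENNReal.ofReal (Real.exp (-‖Complex.polarCoord.symm p‖))) =
      (ENNReal.ofReal (p.1 ^ 1) * ENNReal.ofReal (Real.exp (-p.1))) *
        h (Complex.exp (p.2 * Complex.I)) := by
    rintro ⟨ρ, θ⟩ ⟨hρ : 0 < ρ, -⟩
    have hsymm : Complex.polarCoord.symm (ρ, θ) = ρ • Complex.exp (θ * Complex.I) := by
      rw [Complex.polarCoord_symm_apply, Complex.exp_mul_I, Complex.real_smul]
      push_cast; rfl
    rw [hsymm, hom _ _ hρ, norm_smul, Complex.norm_exp_ofReal_mul_I, mul_one,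
      Real.norm_of_nonneg hρ.le, smul_eq_mul, pow_one]
    ring
  rw [← hexp, ← Complex.lintegral_comp_polarCoord_symm,
    setLIntegral_congr_fun polarCoord.open_target.measurableSet hpolar, polarCoord_target,
    Measure.volume_eq_prod, ← Measure.prod_restrict,
    lintegral_prod_mul
      (f := fun ρ : ℝ => ENNReal.ofReal (ρ ^ 1) * ENNReal.ofReal (Real.exp (-ρ)))
      (g := fun θ : ℝ => h (Complex.exp (θ * Complex.I))) (by fun_prop) (by fun_prop),
    lintegral_pow_mul_exp_neg, Nat.factorial_one, Nat.cast_one, one_mul]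

theorem toSphere_complex_univ :
    (volume : Measure ℂ).toSphere univ = ENNReal.ofReal (2 * Real.pi) := by
  simpa [two_mul] using lintegral_toSphere_complex measurable_one fun _ _ _ => rfl

theorem volume_cos_nonneg_cos_sub_pos {α : ℝ} (h0 : 0 ≤ α) (h1 : α ≤ Real.pi) :
    volume {θ ∈ Ioo (-Real.pi) Real.pi | 0 ≤ Real.cos θ ∧ 0 < Real.cos (α - θ)} =
      ENNReal.ofReal (Real.pi - α) := by
  apply le_antisymm
  · refine (measure_mono (t := Icc (α - Real.pi / 2) (Real.pi / 2)) ?_).trans ?_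
    · rintro θ ⟨⟨hθ1, hθ2⟩, hcos, hcos'⟩
      have hle : θ ≤ Real.pi / 2 := by
        by_contra! h
        linarith [Real.cos_neg_of_pi_div_two_lt_of_lt h (by linarith)]
      have hge : -(Real.pi / 2) ≤ θ := by
        by_contra! h
        have hneg := Real.cos_neg_of_pi_div_two_lt_of_lt (x := -θ) (by linarith) (by linarith)
        linarith [Real.cos_neg θ]
      refine ⟨?_, hle⟩
      by_contra! h
      linarith [Real.cos_nonpos_of_pi_div_two_le_of_le (x := α - θ) (by linarith) (by linarith)]
    · rw [Real.volume_Icc]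
      exact ENNReal.ofReal_le_ofReal (by linarith)
  · refine le_trans ?_ (measure_mono (s := Ioo (α - Real.pi / 2) (Real.pi / 2)) ?_)
    · rw [Real.volume_Ioo]
      exact ENNReal.ofReal_le_ofReal (by linarith)
    · rintro θ ⟨hθ1, hθ2⟩
      have := Real.pi_pos
      exact ⟨⟨by linarith, by linarith⟩, Real.cos_nonneg_of_mem_Icc ⟨by linarith, by linarith⟩,
        Real.cos_pos_of_mem_Ioo ⟨by linarith, by linarith⟩⟩

theorem inner_exp_mul_I (ζ : ℂ) (θ : ℝ) :
    ⟪ζ, Complex.exp (θ * Complex.I)⟫ = ‖ζ‖ * Real.cos (ζ.arg - θ) := by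
  have hre := Complex.norm_mul_cos_arg ζ
  have him := Complex.norm_mul_sin_arg ζ
  rw [Complex.inner, Complex.mul_re, Complex.conj_re, Complex.conj_im,
    Complex.exp_ofReal_mul_I_re, Complex.exp_ofReal_mul_I_im, Real.cos_sub]
  linear_combination -Real.cos θ * hre - Real.sin θ * him

section

variable {E : Type*} [NormedAddCommGroup E] [InnerProductSpace ℝ E]

/-- The convex cone cut out by a closed halfspace with inner normal `a` and an open halfspace with
inner normal `b`; it meets the sphere in a lune. -/
def lune (a b : E) : Set E := {x | 0 ≤ ⟪a, x⟫ ∧ 0 < ⟪b, x⟫}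

theorem measurableSet_lune [MeasurableSpace E] [BorelSpace E] (a b : E) :
    MeasurableSet (lune a b) := by
  unfold lune
  measurability

theorem lune_indicator_smul (a b : E) (r : ℝ) (x : E) (hr : 0 < r) :
    (lune a b).indicator (1 : E → ℝ≥0∞) (r • x) = (lune a b).indicator 1 x := by
  classical
  refine if_congr ?_ rfl rfl
  simp only [lune, mem_ofPred_eq, inner_smul_right, mul_nonneg_iff_of_pos_left hr,
    mul_pos_iff_of_pos_left hr]

theorem lintegral_toSphere_lune_one {ζ : ℂ} (hζ : ζ ≠ 0) (him : 0 ≤ ζ.im) :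
    ∫⁻ v : sphere (0 : ℂ) 1, (lune 1 ζ).indicator 1 (v : ℂ) ∂(volume : Measure ℂ).toSphere =
      ENNReal.ofReal (Real.pi - ζ.arg) := by
  have hmem (θ : ℝ) : Complex.exp (θ * Complex.I) ∈ lune 1 ζ ↔
      0 ≤ Real.cos θ ∧ 0 < Real.cos (ζ.arg - θ) := by
    simp [lune, inner_exp_mul_I, hζ, -Complex.inner]
  have hmeas : MeasurableSet {θ : ℝ | Complex.exp (θ * Complex.I) ∈ lune 1 ζ} :=
    (show Measurable fun θ : ℝ => Complex.exp (θ * Complex.I) by fun_prop) (measurableSet_lune 1 ζ)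
  rw [lintegral_toSphere_complex (measurable_one.indicator (measurableSet_lune 1 ζ))
      (lune_indicator_smul 1 ζ),
    ← volume_cos_nonneg_cos_sub_pos (Complex.arg_nonneg_iff.2 him) (Complex.arg_le_pi ζ)]
  calc ∫⁻ θ in Ioo (-Real.pi) Real.pi, (lune 1 ζ).indicator 1 (Complex.exp (θ * Complex.I))
      = ∫⁻ θ in Ioo (-Real.pi) Real.pi,
          {θ : ℝ | Complex.exp (θ * Complex.I) ∈ lune 1 ζ}.indicator 1 θ := rfl
    _ = _ := by
      rw [lintegral_indicator_one hmeas, Measure.restrict_apply hmeas, inter_comm]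
      simp_rw [hmem]
      rfl

theorem exists_norm_eq_one_smul [Nontrivial E] (v : E) : ∃ b : E, ‖b‖ = 1 ∧ v = ‖v‖ • b := by
  by_cases hv : v = 0
  · obtain ⟨b, hb⟩ := _root_.exists_norm_eq E zero_le_one
    exact ⟨b, hb, by simp [hv]⟩
  · exact ⟨‖v‖⁻¹ • v, norm_smul_inv_norm hv, by simp [hv]⟩

/-- The isometric embedding of the plane with `1 ↦ a` and `I ↦ b`, for orthonormal `a`, `b`. -/
def planeIsometry {a b : E} (ha : ‖a‖ = 1) (hb : ‖b‖ = 1) (hab : ⟪a, b⟫ = 0) : ℂ →ₗᵢ[ℝ] E where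
  toLinearMap := Complex.reLm.smulRight a + Complex.imLm.smulRight b
  norm_map' z := by
    have hsq : ‖z.re • a + z.im • b‖ ^ 2 = ‖z‖ ^ 2 := by
      rw [norm_add_sq_real, norm_smul, norm_smul, inner_smul_left, inner_smul_right, ha, hb, hab,
        Complex.sq_norm, Complex.normSq_apply]
      simp only [Real.norm_eq_abs, mul_one, sq_abs, mul_zero]
      ring
    exact (sq_eq_sq₀ (norm_nonneg _) (norm_nonneg _)).1 hsq

theorem exists_linearIsometry_complex [FiniteDimensional ℝ E] (hE : 1 < finrank ℝ E) {e : E}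
    (he : ‖e‖ = 1) (w : E) : ∃ (i : ℂ →ₗᵢ[ℝ] E) (ζ : ℂ), i 1 = e ∧ i ζ = w ∧ 0 ≤ ζ.im := by
  have : Nontrivial (ℝ ∙ e)ᗮ := by
    have hadd := Submodule.finrank_add_finrank_orthogonal (ℝ ∙ e)
    rw [finrank_span_singleton (norm_ne_zero_iff.1 (by simp [he]))] at hadd
    exact nontrivial_of_finrank_pos (R := ℝ) (by omega)
  obtain ⟨b, hb, hv⟩ := exists_norm_eq_one_smul ((ℝ ∙ e)ᗮ.orthogonalProjectionOnto w)
  set v := (ℝ ∙ e)ᗮ.orthogonalProjectionOnto w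
  have hw : w = ⟪e, w⟫ • e + (v : E) := by
    rw [← Submodule.starProjection_unit_singleton ℝ he]
    exact ((ℝ ∙ e).starProjection_add_starProjection_orthogonal w).symm
  refine ⟨planeIsometry he hb (Submodule.mem_orthogonal_singleton_iff_inner_right.1 b.2),
    ⟨⟪e, w⟫, ‖v‖⟩, ?_, ?_, norm_nonneg v⟩
  · simp [planeIsometry]
  · conv_rhs => rw [hw, hv]
    simp [planeIsometry]

variable [FiniteDimensional ℝ E] [MeasurableSpace E] [BorelSpace E]

theorem toSphere_lune (hE : 1 < finrank ℝ E) {e w : E} (he : ‖e‖ = 1) (hw : w ≠ 0) :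
    (volume : Measure E).toSphere {u | (u : E) ∈ lune e w} =
      ENNReal.ofReal (omega (finrank ℝ E) * ((Real.pi - angle w e) / (2 * Real.pi))) := by
  have : Nontrivial E := nontrivial_of_finrank_pos (R := ℝ) (by omega)
  obtain ⟨i, ζ, rfl, rfl, him⟩ := exists_linearIsometry_complex hE he w
  have hζ : ζ ≠ 0 := by
    rintro rfl
    exact hw i.map_zero
  have hangle : angle (i ζ) (i 1) = ζ.arg := by
    rw [i.angle_map, Complex.angle_one_right hζ, abs_of_nonneg (Complex.arg_nonneg_iff.2 him)]
  have hmeas : MeasurableSet {u : sphere (0 : E) 1 | (u : E) ∈ lune (i 1) (i ζ)} :=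
    measurable_subtype_coe (measurableSet_lune _ _)
  have hproj := lintegral_toSphere_adjoint i (measurable_one.indicator (measurableSet_lune 1 ζ))
    (lune_indicator_smul 1 ζ)
  have hind (u : sphere (0 : E) 1) :
      (lune 1 ζ).indicator (1 : ℂ → ℝ≥0∞) (i.toContinuousLinearMap.adjoint u) =
      {u : sphere (0 : E) 1 | (u : E) ∈ lune (i 1) (i ζ)}.indicator 1 u := by
    classical
    exact if_congr (by simp only [lune, mem_ofPred_eq, ContinuousLinearMap.adjoint_inner_right,
      LinearIsometry.coe_toContinuousLinearMap]) rfl rfl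
  have hpi : ENNReal.ofReal (2 * Real.pi) ≠ 0 := by simp [Real.pi_pos]
  simp_rw [hind] at hproj
  rw [lintegral_indicator_one hmeas, lintegral_toSphere_lune_one hζ him, toSphere_complex_univ,
    toSphere_univ_eq_omega, mul_comm, ← ENNReal.eq_div_iff hpi (by finiteness)] at hproj
  rw [hproj, hangle, ← ENNReal.ofReal_mul (by linarith [Complex.arg_le_pi ζ]),
    ← ENNReal.ofReal_div_of_pos Real.two_pi_pos, mul_comm (Real.pi - _), mul_div_assoc]

end

end Lune

theorem uniformHalfsphere_inner_pos {d : ℕ} (hd : 1 ≤ d) (e : UnitSphere d) {w : Space d}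
    (hw : w ≠ 0) :
    uniformHalfsphere e {u | 0 < ⟪w, (u : Space d)⟫} =
      ENNReal.ofReal (1 - angle w (e : Space d) / Real.pi) := by
  have hmeas : MeasurableSet {u : UnitSphere d | 0 < ⟪w, (u : Space d)⟫} :=
    measurableSet_lt measurable_const (by fun_prop)
  have hlune : {u : UnitSphere d | 0 < ⟪w, (u : Space d)⟫} ∩ halfsphere e =
      {u : UnitSphere d | (u : Space d) ∈ lune (e : Space d) w} := by
    ext u
    rw [halfsphere, mem_inter_iff, and_comm]
    simp only [lune, mem_ofPred_eq, real_inner_comm]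
  have hω := omega_pos (k := d + 1) (by omega)
  rw [uniformHalfsphere, Measure.smul_apply, Measure.restrict_apply hmeas, hlune, sphereMeasure,
    toSphere_lune (by simpa using Nat.lt_add_one_of_le hd) (norm_eq_of_mem_sphere e) hw,
    smul_eq_mul, ← ENNReal.ofReal_mul (by positivity), finrank_euclideanSpace_fin]
  congr 1
  field_simp

section Angle

theorem lintegral_upperHalfPlane {F : ℝ × ℝ → ℝ≥0∞} (hF : Measurable F) :
    ∫⁻ t : ℝ, ∫⁻ s in Ioi (0 : ℝ), F (t, s) =
      ∫⁻ p in Ioi (0 : ℝ) ×ˢ Ioo 0 Real.pi, ENNReal.ofReal p.1 * F (polarCoord.symm p) := by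
  have hpos : MeasurableSet {p : ℝ × ℝ | 0 < p.2} := measurableSet_lt (by fun_prop) (by fun_prop)
  have hpolar : ∀ p ∈ polarCoord.target,
      ENNReal.ofReal p.1 • {p : ℝ × ℝ | 0 < p.2}.indicator F (polarCoord.symm p) =
      (univ ×ˢ Ioi 0).indicator (fun p => ENNReal.ofReal p.1 * F (polarCoord.symm p)) p := by
    rintro ⟨ρ, θ⟩ ⟨hρ : 0 < ρ, hθ : -Real.pi < θ, hθ' : θ < Real.pi⟩
    have hsin : 0 < ρ * Real.sin θ ↔ 0 < θ := by
      rw [mul_pos_iff_of_pos_left hρ]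
      refine ⟨fun h => ?_, fun h => Real.sin_pos_of_pos_of_lt_pi h hθ'⟩
      contrapose! h
      exact Real.sin_nonpos_of_nonpos_of_neg_pi_le h hθ.le
    by_cases h : 0 < θ <;> simp [indicator, polarCoord_symm_apply, hsin, h]
  have htarget : polarCoord.target ∩ univ ×ˢ Ioi 0 = Ioi (0 : ℝ) ×ˢ Ioo 0 Real.pi := by
    rw [polarCoord_target, prod_inter_prod, inter_univ, Ioo_inter_Ioi,
      max_eq_right (neg_nonpos.2 Real.pi_pos.le)]
  calc ∫⁻ t : ℝ, ∫⁻ s in Ioi (0 : ℝ), F (t, s)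
      = ∫⁻ p, {p : ℝ × ℝ | 0 < p.2}.indicator F p := by
        rw [Measure.volume_eq_prod, lintegral_prod _ (hF.indicator hpos).aemeasurable]
        exact lintegral_congr fun t => (lintegral_indicator measurableSet_Ioi _).symm
    _ = _ := by
        rw [← lintegral_comp_polarCoord_symm,
          setLIntegral_congr_fun polarCoord.open_target.measurableSet hpolar,
          setLIntegral_indicator (MeasurableSet.univ.prod measurableSet_Ioi), inter_comm, htarget]

variable {E : Type*} [NormedAddCommGroup E] [InnerProductSpace ℝ E]

theorem finrank_add_finrank_range_orthogonal {K : Type*} [NormedAddCommGroup K]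
    [InnerProductSpace ℝ K] [FiniteDimensional ℝ E] (i : K →ₗᵢ[ℝ] E) :
    finrank ℝ K + finrank ℝ (i.range)ᗮ = finrank ℝ E := by
  rw [← LinearMap.finrank_range_of_inj i.injective]
  exact Submodule.finrank_add_finrank_orthogonal _

/-- The function `g (angle e x) * exp (-‖x‖)` of a vector `x = t • e + z`, with `e` a unit vector
and `z` orthogonal to `e`, as a function of the pair `(t, ‖z‖)`. -/
def angleWeight (g : ℝ → ℝ≥0∞) (p : ℝ × ℝ) : ℝ≥0∞ :=
  g (Real.arccos (p.1 / √(p.1 ^ 2 + p.2 ^ 2))) * ENNReal.ofReal (Real.exp (-√(p.1 ^ 2 + p.2 ^ 2)))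

@[fun_prop]
theorem measurable_angleWeight {g : ℝ → ℝ≥0∞} (hg : Measurable g) : Measurable (angleWeight g) := by
  unfold angleWeight
  fun_prop

theorem angleWeight_polarCoord_symm (g : ℝ → ℝ≥0∞) {ρ α : ℝ} (hρ : 0 < ρ)
    (hα : α ∈ Ioo 0 Real.pi) :
    angleWeight g (polarCoord.symm (ρ, α)) = g α * ENNReal.ofReal (Real.exp (-ρ)) := by
  have hsq : (ρ * Real.cos α) ^ 2 + (ρ * Real.sin α) ^ 2 = ρ ^ 2 := by
    linear_combination ρ ^ 2 * Real.sin_sq_add_cos_sq α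
  simp only [angleWeight, polarCoord_symm_apply, hsq, Real.sqrt_sq hρ.le,
    mul_div_cancel_left₀ _ hρ.ne', Real.arccos_cos hα.1.le hα.2.le]

theorem angleWeight_norm_orthogonal {e : E} (he : ‖e‖ = 1) (g : ℝ → ℝ≥0∞) (t : ℝ)
    (z : ((LinearIsometry.toSpanSingleton ℝ E he).range)ᗮ) :
    angleWeight g (t, ‖z‖) = g (angle e (LinearIsometry.toSpanSingleton ℝ E he t + z)) *
      ENNReal.ofReal (Real.exp (-‖LinearIsometry.toSpanSingleton ℝ E he t + (z : E)‖)) := by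
  have hz : ⟪e, (z : E)⟫ = 0 := z.2 e ⟨1, by simp⟩
  have hinner : ⟪e, LinearIsometry.toSpanSingleton ℝ E he t + (z : E)⟫ = t := by
    simp [inner_add_right, inner_smul_right, he, hz]
  simp only [angleWeight, angle, hinner, he, one_mul, norm_map_add_orthogonal, Real.norm_eq_abs,
    sq_abs]

theorem lintegral_upperHalfPlane_angleWeight (k : ℕ) {g : ℝ → ℝ≥0∞} (hg : Measurable g) :
    ∫⁻ t : ℝ, ∫⁻ s in Ioi (0 : ℝ), ENNReal.ofReal (s ^ k) * angleWeight g (t, s) =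
      (k + 1).factorial *
        ∫⁻ α in Ioo (0 : ℝ) Real.pi, ENNReal.ofReal (Real.sin α ^ k) * g α := by
  have hpolar : ∀ p ∈ Ioi (0 : ℝ) ×ˢ Ioo 0 Real.pi, ENNReal.ofReal p.1 *
      (ENNReal.ofReal ((polarCoord.symm p).2 ^ k) * angleWeight g (polarCoord.symm p)) =
      (ENNReal.ofReal (p.1 ^ (k + 1)) * ENNReal.ofReal (Real.exp (-p.1))) *
        (ENNReal.ofReal (Real.sin p.2 ^ k) * g p.2) := by
    rintro ⟨ρ, α⟩ ⟨hρ : 0 < ρ, hα⟩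
    rw [angleWeight_polarCoord_symm g hρ hα, polarCoord_symm_apply, mul_pow, pow_succ,
      ENNReal.ofReal_mul (by positivity), ENNReal.ofReal_mul (by positivity)]
    ring
  rw [lintegral_upperHalfPlane (F := fun p => ENNReal.ofReal (p.2 ^ k) * angleWeight g p)
      (by fun_prop),
    setLIntegral_congr_fun (measurableSet_Ioi.prod measurableSet_Ioo) hpolar,
    Measure.volume_eq_prod, ← Measure.prod_restrict,
    lintegral_prod_mul
      (f := fun ρ : ℝ => ENNReal.ofReal (ρ ^ (k + 1)) * ENNReal.ofReal (Real.exp (-ρ)))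
      (g := fun α : ℝ => ENNReal.ofReal (Real.sin α ^ k) * g α) (by fun_prop) (by fun_prop),
    lintegral_pow_mul_exp_neg]

variable [FiniteDimensional ℝ E] [MeasurableSpace E] [BorelSpace E]

@[fun_prop]
theorem measurable_angle {α : Type*} [MeasurableSpace α] {f g : α → E} (hf : Measurable f)
    (hg : Measurable g) : Measurable fun a => angle (f a) (g a) := by
  unfold angle
  fun_prop

theorem lintegral_angle {d : ℕ} (hd : 1 ≤ d) (hE : finrank ℝ E = d + 1) {e : E} (he : ‖e‖ = 1)
    {g : ℝ → ℝ≥0∞} (hg : Measurable g) :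
    ∫⁻ u : sphere (0 : E) 1, g (angle e (u : E)) ∂(volume : Measure E).toSphere =
      ENNReal.ofReal (omega d) *
        ∫⁻ α in Ioo (0 : ℝ) Real.pi, ENNReal.ofReal (Real.sin α ^ (d - 1)) * g α := by
  have : Nontrivial E := nontrivial_of_finrank_pos (R := ℝ) (by omega)
  let i := LinearIsometry.toSpanSingleton ℝ E he
  have hperp : finrank ℝ (i.range)ᗮ = d := by
    have := finrank_add_finrank_range_orthogonal i
    rw [finrank_self] at this
    omega
  have : Nontrivial (i.range)ᗮ := nontrivial_of_finrank_pos (R := ℝ) (by omega)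
  have hfac : ((finrank ℝ E - 1).factorial : ℝ≥0∞) ≠ 0 := by
    exact_mod_cast Nat.factorial_ne_zero _
  have hweight (t : ℝ) (z : (i.range)ᗮ) :
      g (angle e (i t + z)) * ENNReal.ofReal (Real.exp (-‖i t + (z : E)‖)) =
        angleWeight g (t, ‖z‖) := (angleWeight_norm_orthogonal he g t z).symm
  have hradial (t : ℝ) : ∫⁻ z : (i.range)ᗮ, angleWeight g (t, ‖z‖) = ENNReal.ofReal (omega d) *
      ∫⁻ s in Ioi (0 : ℝ), ENNReal.ofReal (s ^ (d - 1)) * angleWeight g (t, s) := by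
    rw [lintegral_fun_norm volume (φ := fun s => angleWeight g (t, s)) (by fun_prop),
      toSphere_univ_eq_omega, hperp]
  rw [← ENNReal.mul_left_inj hfac (by finiteness),
    ← lintegral_mul_exp_neg_norm volume (g := fun x => g (angle e x)) (by fun_prop)
      fun r x hr => by
      simp only [angle_smul_right_of_pos _ _ hr],
    lintegral_eq_lintegral_orthogonal i
      (F := fun x => g (angle e x) * ENNReal.ofReal (Real.exp (-‖x‖))) (by fun_prop)]
  simp_rw [hweight, hradial]
  rw [lintegral_const_mul _ (by fun_prop), lintegral_upperHalfPlane_angleWeight _ hg, hE,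
    Nat.sub_add_cancel hd, Nat.add_sub_cancel]
  ring

end Angle

section NormalVector

theorem span_range_ne_top {V : Type*} [AddCommGroup V] [Module ℝ V] {k : ℕ} (hk : k < finrank ℝ V)
    (x : Fin k → V) : Submodule.span ℝ (range x) ≠ ⊤ := fun h => by
  have hle := finrank_range_le_card (R := ℝ) x
  rw [Set.finrank, h, finrank_top, Fintype.card_fin] at hle
  exact hk.not_ge hle

variable {E : Type*} [NormedAddCommGroup E] [InnerProductSpace ℝ E] {k : ℕ}
  (b : OrthonormalBasis (Fin (k + 1)) ℝ E)

/-- The cross product of `k` vectors of a `(k + 1)`-dimensional space with an orthonormal basis `b`: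
the vector representing the functional `y ↦ det (y, x 0, …, x (k - 1))`. -/
def normalVec (x : Fin k → E) : E :=
  ∑ i, b.toBasis.det (Fin.cons (b i) x) • b i

theorem inner_normalVec (x : Fin k → E) (y : E) :
    ⟪normalVec b x, y⟫ = b.toBasis.det (Fin.cons y x) := by
  let φ : E →ₗ[ℝ] ℝ := b.toBasis.det.toMultilinearMap.toLinearMap (Fin.cons 0 x) 0
  have hφ (y : E) : φ y = b.toBasis.det (Fin.cons y x) := by
    simp only [φ, MultilinearMap.toLinearMap_apply, Fin.update_cons_zero]
    rfl
  have heq : innerₛₗ ℝ (normalVec b x) = φ := b.toBasis.ext fun i => by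
    simp [hφ, normalVec, b.inner_eq_ite]
  rw [← hφ, ← heq, innerₛₗ_apply_apply]

theorem inner_normalVec_ne_zero_iff {x : Fin k → E} (hx : LinearIndependent ℝ x) {y : E} :
    ⟪normalVec b x, y⟫ ≠ 0 ↔ y ∉ Submodule.span ℝ (range x) := by
  have : FiniteDimensional ℝ E := b.toBasis.finiteDimensional_of_finite
  have hcard : Fintype.card (Fin (k + 1)) = finrank ℝ E := (finrank_eq_card_basis b.toBasis).symm
  rw [inner_normalVec, ← isUnit_iff_ne_zero, ← b.toBasis.is_basis_iff_det]
  refine ⟨fun h => (linearIndependent_finCons.1 h.1).2, fun h => ?_⟩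
  have hLI := linearIndependent_finCons.2 ⟨hx, h⟩
  exact ⟨hLI, hLI.span_eq_top_of_card_eq_finrank' hcard⟩

theorem normalVec_ne_zero {x : Fin k → E} (hx : LinearIndependent ℝ x) : normalVec b x ≠ 0 := by
  have hk : k < finrank ℝ E := by simp [finrank_eq_card_basis b.toBasis]
  obtain ⟨y, hy⟩ := SetLike.exists_not_mem_of_ne_top _ (span_range_ne_top hk x) rfl
  exact fun h => (inner_normalVec_ne_zero_iff b hx).2 hy (by rw [h, inner_zero_left])

theorem normalVec_smul (c : Fin k → ℝ) (x : Fin k → E) :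
    normalVec b (fun i => c i • x i) = (∏ i, c i) • normalVec b x := by
  refine ext_inner_right ℝ fun y => ?_
  have hcons : (Fin.cons y fun i => c i • x i : Fin (k + 1) → E) =
      fun i => (Fin.cons 1 c : Fin (k + 1) → ℝ) i • (Fin.cons y x : Fin (k + 1) → E) i := by
    funext i
    cases i using Fin.cases <;> simp
  rw [real_inner_smul_left, inner_normalVec, inner_normalVec, hcons,
    AlternatingMap.map_smul_univ]
  simp [Fin.prod_univ_succ]

theorem exists_normalVec_map (R : E ≃ₗᵢ[ℝ] E) :
    ∃ c : ℝ, c ≠ 0 ∧ ∀ x : Fin k → E, normalVec b (R ∘ x) = c • R (normalVec b x) := by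
  refine ⟨LinearMap.det (R.toLinearEquiv : E →ₗ[ℝ] E), R.toLinearEquiv.isUnit_det'.ne_zero,
    fun x => ext_inner_right ℝ fun y => ?_⟩
  obtain ⟨z, rfl⟩ := R.surjective y
  rw [real_inner_smul_left, R.inner_map_map, inner_normalVec, inner_normalVec,
    ← b.toBasis.det_comp]
  congr 1
  funext i
  cases i using Fin.cases <;> simp

theorem continuous_normalVec : Continuous (normalVec b) := by
  unfold normalVec
  refine continuous_finsetSum _ fun i _ => Continuous.smul ?_ continuous_const
  simp only [Basis.det_apply]
  refine Continuous.matrix_det (continuous_matrix fun j l => ?_)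
  simp only [Basis.toMatrix_apply, OrthonormalBasis.coe_toBasis_repr_apply,
    b.repr_apply_apply]
  cases l using Fin.cases <;> simp only [Fin.cons_zero, Fin.cons_succ] <;> fun_prop

@[fun_prop]
theorem measurable_normalVec [MeasurableSpace E] [BorelSpace E] {α : Type*} [MeasurableSpace α]
    {x : α → Fin k → E} (hx : Measurable x) : Measurable fun a => normalVec b (x a) := by
  have : FiniteDimensional ℝ E := b.toBasis.finiteDimensional_of_finite
  exact (continuous_normalVec b).measurable.comp hx

end NormalVector

section UniformSphere

variable {E : Type*} [NormedAddCommGroup E] [InnerProductSpace ℝ E]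

/-- The action of a linear isometry on the unit sphere. -/
def sphereMap (R : E ≃ₗᵢ[ℝ] E) (u : sphere (0 : E) 1) : sphere (0 : E) 1 :=
  ⟨R u, by simp⟩

variable [MeasurableSpace E] [BorelSpace E]

theorem measurable_sphereMap (R : E ≃ₗᵢ[ℝ] E) : Measurable (sphereMap R) :=
  (R.continuous.measurable.comp measurable_subtype_coe).subtype_mk

variable [FiniteDimensional ℝ E]

open scoped Pointwise in
theorem measurePreserving_sphereMap (R : E ≃ₗᵢ[ℝ] E) :
    MeasurePreserving (sphereMap R) (volume : Measure E).toSphere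
      (volume : Measure E).toSphere := by
  refine ⟨measurable_sphereMap R, Measure.ext fun s hs => ?_⟩
  have hcone : Ioo (0 : ℝ) 1 • (((↑) : sphere (0 : E) 1 → E) '' (sphereMap R ⁻¹' s)) =
      R ⁻¹' (Ioo (0 : ℝ) 1 • (((↑) : sphere (0 : E) 1 → E) '' s)) := by
    ext x
    simp only [Set.mem_smul, mem_image, mem_preimage, exists_exists_and_eq_and]
    refine exists_congr fun r => and_congr_right fun _ => ⟨?_, ?_⟩
    · rintro ⟨u, hu, rfl⟩
      exact ⟨_, hu, (R.map_smul r u).symm⟩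
    · rintro ⟨u, hu, hx⟩
      have hR : sphereMap R (sphereMap R.symm u) = u := Subtype.ext (R.apply_symm_apply u)
      exact ⟨sphereMap R.symm u, by rwa [hR], R.injective (by simp [sphereMap, ← hx])⟩
  rw [Measure.map_apply (measurable_sphereMap R) hs, Measure.toSphere_apply' _ hs,
    Measure.toSphere_apply' _ (measurable_sphereMap R hs), hcone,
    R.measurePreserving.measure_preimage_emb R.toHomeomorph.measurableEmbedding]

theorem toSphere_submodule {V : Submodule ℝ E} (hV : V ≠ ⊤) :
    (volume : Measure E).toSphere {u | (u : E) ∈ V} = 0 := by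
  have hmeas : MeasurableSet {u : sphere (0 : E) 1 | (u : E) ∈ V} :=
    measurable_subtype_coe V.closed_of_finiteDimensional.measurableSet
  rw [Measure.toSphere_apply' _ hmeas]
  refine mul_eq_zero_of_right _ (measure_mono_null ?_ (Measure.addHaar_submodule volume V hV))
  rintro _ ⟨r, -, _, ⟨u, hu, rfl⟩, rfl⟩
  exact V.smul_mem r hu

theorem ae_toSphere_inner_ne_zero {w : E} (hw : w ≠ 0) :
    ∀ᵐ u : sphere (0 : E) 1 ∂(volume : Measure E).toSphere, ⟪w, (u : E)⟫ ≠ 0 := by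
  have hperp : (ℝ ∙ w)ᗮ ≠ ⊤ := by simpa [Submodule.orthogonal_eq_top_iff] using hw
  simpa [ae_iff, Submodule.mem_orthogonal_singleton_iff_inner_right] using toSphere_submodule hperp

theorem ae_linearIndependent {α : Type*} [MeasurableSpace α] {ρ : Measure α} [SigmaFinite ρ]
    {f : α → E} (hf : Measurable f) (hρ : ∀ V : Submodule ℝ E, V ≠ ⊤ → ρ (f ⁻¹' V) = 0) {k : ℕ}
    (hk : k ≤ finrank ℝ E) :
    ∀ᵐ x ∂Measure.pi fun _ : Fin k => ρ, LinearIndependent ℝ (f ∘ x) := by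
  induction k with
  | zero => exact .of_forall fun _ => linearIndependent_empty_type
  | succ k ih =>
    have hmeas : MeasurableSet {x : Fin (k + 1) → α | LinearIndependent ℝ (f ∘ x)} :=
      (measurable_pi_lambda _ fun i => hf.comp (measurable_pi_apply i))
        isOpen_setOfPred_linearIndependent.measurableSet
    have hmp := (measurePreserving_piFinSuccAbove (fun _ : Fin (k + 1) => ρ) 0).symm.comp
      (Measure.measurePreserving_swap (μ := Measure.pi fun _ : Fin k => ρ) (ν := ρ))
    rw [← hmp.map_eq, ae_map_iff hmp.measurable.aemeasurable hmeas]
    refine (Measure.ae_prod_iff_ae_ae (hmp.measurable hmeas)).2 ?_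
    filter_upwards [ih (by omega)] with x hx
    filter_upwards [measure_eq_zero_iff_ae_notMem.1 (hρ _ (span_range_ne_top hk (f ∘ x)))] with y hy
    have hcons : LinearIndependent ℝ (Fin.cons (f y) (f ∘ x) : Fin (k + 1) → E) :=
      linearIndependent_finCons.2 ⟨hx, hy⟩
    convert hcons
    funext i
    cases i using Fin.cases <;>
      simp [MeasurableEquiv.piFinSuccAbove, Fin.insertNthEquiv, Fin.insertNth_zero']

end UniformSphere

section Halfsphere

variable {d : ℕ}

/-- The uniform probability measure on the sphere. -/
def uniformSphere (d : ℕ) : Measure (UnitSphere d) :=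
  ENNReal.ofReal (1 / omega (d + 1)) • sphereMeasure d

instance (d : ℕ) : IsProbabilityMeasure (uniformSphere d) := by
  have hω := omega_pos d.succ_pos
  constructor
  rw [uniformSphere, Measure.smul_apply, sphereMeasure, toSphere_univ_eq_omega,
    finrank_euclideanSpace_fin, smul_eq_mul, ← ENNReal.ofReal_mul (by positivity),
    one_div_mul_cancel hω.ne', ENNReal.ofReal_one]

theorem uniformSphere_submodule {V : Submodule ℝ (Space d)} (hV : V ≠ ⊤) :
    uniformSphere d {u | (u : Space d) ∈ V} = 0 :=
  Measure.smul_absolutelyContinuous (toSphere_submodule hV)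

theorem uniformHalfsphere_submodule (e : UnitSphere d) {V : Submodule ℝ (Space d)} (hV : V ≠ ⊤) :
    uniformHalfsphere e {u | (u : Space d) ∈ V} = 0 :=
  Measure.smul_absolutelyContinuous
    (Measure.restrict_le_self.absolutelyContinuous (toSphere_submodule hV))

theorem measurePreserving_sphereMap_uniformSphere (R : Space d ≃ₗᵢ[ℝ] Space d) :
    MeasurePreserving (sphereMap R) (uniformSphere d) (uniformSphere d) :=
  (measurePreserving_sphereMap R).smul_measure _

/-- The map of the sphere onto the halfsphere with pole `e` which identifies antipodal points. -/
def foldTo (e u : UnitSphere d) : UnitSphere d :=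
  if 0 ≤ ⟪(u : Space d), (e : Space d)⟫ then u else -u

theorem measurableSet_halfsphere (e : UnitSphere d) : MeasurableSet (halfsphere e) :=
  measurableSet_le measurable_const (by fun_prop)

theorem measurable_foldTo (e : UnitSphere d) : Measurable (foldTo e) :=
  .ite (measurableSet_halfsphere e) measurable_id (measurable_sphereMap (.neg ℝ))

theorem exists_foldTo_eq_smul (e u : UnitSphere d) :
    ∃ c : ℝ, c ≠ 0 ∧ (foldTo e u : Space d) = c • (u : Space d) := by
  unfold foldTo
  split_ifs
  · exact ⟨1, one_ne_zero, by simp⟩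
  · exact ⟨-1, by simp, by simp⟩

theorem map_foldTo (e : UnitSphere d) : (uniformSphere d).map (foldTo e) = uniformHalfsphere e := by
  refine Measure.ext fun s hs => ?_
  have hmem (u : UnitSphere d) : u ∈ halfsphere e ↔ 0 ≤ ⟪(u : Space d), (e : Space d)⟫ := .rfl
  have hinter : foldTo e ⁻¹' s ∩ halfsphere e = s ∩ halfsphere e := by
    ext u
    refine and_congr_left fun hu => ?_
    rw [mem_preimage, foldTo, if_pos ((hmem u).1 hu)]
  have hdiff : (foldTo e ⁻¹' s \ halfsphere e : Set (UnitSphere d)) =ᵐ[sphereMeasure d]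
      sphereMap (.neg ℝ) ⁻¹' (s ∩ halfsphere e) := by
    filter_upwards [ae_toSphere_inner_ne_zero (ne_zero_of_mem_unit_sphere e)] with u hu
    rw [real_inner_comm] at hu
    refine propext ?_
    change foldTo e u ∈ s ∧ u ∉ halfsphere e ↔ -u ∈ s ∧ -u ∈ halfsphere e
    rw [foldTo, hmem, hmem, coe_neg_sphere, inner_neg_left]
    rcases hu.lt_or_gt with h | h
    · simp [h.not_ge, h.le]
    · simp [h.not_ge, h.le]
  have hneg : MeasurePreserving (sphereMap (.neg ℝ)) (sphereMeasure d) (sphereMeasure d) :=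
    measurePreserving_sphereMap _
  have htwo : ENNReal.ofReal (2 / omega (d + 1)) = ENNReal.ofReal (1 / omega (d + 1)) * 2 := by
    rw [← ENNReal.ofReal_ofNat 2, ← ENNReal.ofReal_mul' zero_le_two, div_mul_eq_mul_div, one_mul]
  rw [Measure.map_apply (measurable_foldTo e) hs, uniformSphere, uniformHalfsphere,
    Measure.smul_apply, Measure.smul_apply, Measure.restrict_apply hs,
    ← measure_inter_add_sdiff _ (measurableSet_halfsphere e), hinter, measure_congr hdiff,
    hneg.measure_preimage (hs.inter (measurableSet_halfsphere e)).nullMeasurableSet,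
    ← two_mul, smul_eq_mul, smul_eq_mul, htwo, mul_assoc]

instance (e : UnitSphere d) : IsProbabilityMeasure (uniformHalfsphere e) := by
  rw [← map_foldTo e]
  exact Measure.isProbabilityMeasure_map (measurable_foldTo e).aemeasurable

theorem lintegral_angle_uniformSphere (hd : 1 ≤ d) {w : Space d} (hw : w ≠ 0)
    {g : ℝ → ℝ≥0∞} (hg : Measurable g) :
    ∫⁻ u : UnitSphere d, g (angle w (u : Space d)) ∂(uniformSphere d) =
      ENNReal.ofReal (omega d / omega (d + 1)) *
        ∫⁻ α in Ioo (0 : ℝ) Real.pi, ENNReal.ofReal (Real.sin α ^ (d - 1)) * g α := by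
  have hω := omega_pos d.succ_pos
  have hunit : ‖‖w‖⁻¹ • w‖ = 1 := norm_smul_inv_norm hw
  simp_rw [← fun u => angle_smul_left_of_pos w u (inv_pos.2 (norm_pos_iff.2 hw))]
  rw [uniformSphere, lintegral_smul_measure, sphereMeasure,
    lintegral_angle hd finrank_euclideanSpace_fin hunit hg, smul_eq_mul, ← mul_assoc,
    ← ENNReal.ofReal_mul (by positivity), one_div_mul_eq_div]

end Halfsphere

section NormalAngle

variable {d : ℕ} (b : OrthonormalBasis (Fin (d + 1)) ℝ (Space d)) {g : ℝ → ℝ≥0∞}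

theorem apply_angle_smul_left {E : Type*} [NormedAddCommGroup E] [InnerProductSpace ℝ E]
    (hs : ∀ α, g (Real.pi - α) = g α) {c : ℝ} (hc : c ≠ 0) (v w : E) :
    g (angle (c • v) w) = g (angle v w) := by
  rcases hc.lt_or_gt with h | h
  · rw [angle_smul_left_of_neg _ _ h, angle_neg_left, hs]
  · rw [angle_smul_left_of_pos _ _ h]

theorem lintegral_angle_normalVec_congr_pole (hg : Measurable g)
    (hs : ∀ α, g (Real.pi - α) = g α) (e e' : UnitSphere d) :
    ∫⁻ x, g (angle (normalVec b fun i => (x i : Space d)) e)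
        ∂(Measure.pi fun _ : Fin d => uniformSphere d) =
      ∫⁻ x, g (angle (normalVec b fun i => (x i : Space d)) e')
        ∂(Measure.pi fun _ : Fin d => uniformSphere d) := by
  let R : Space d ≃ₗᵢ[ℝ] Space d := (ℝ ∙ ((e : Space d) - e'))ᗮ.reflection
  have hR : R e = e' := Submodule.reflection_sub (by simp)
  obtain ⟨c, hc, hcR⟩ := exists_normalVec_map b R
  have hmp := measurePreserving_pi (fun _ : Fin d => uniformSphere d)
    (fun _ : Fin d => uniformSphere d) fun _ => measurePreserving_sphereMap_uniformSphere R
  rw [← hmp.lintegral_comp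
    (f := fun x => g (angle (normalVec b fun i => (x i : Space d)) e')) (by fun_prop)]
  refine lintegral_congr fun x => ?_
  have hx : (normalVec b fun i => (sphereMap R (x i) : Space d)) =
      c • R (normalVec b fun i => (x i : Space d)) := hcR _
  rw [hx, apply_angle_smul_left hs hc, ← hR]
  exact congrArg g (R.toLinearIsometry.angle_map _ _).symm

-- By rotation invariance the pole may be averaged over the sphere, and then the normal vector can
-- be kept fixed.
theorem lintegral_angle_normalVec_uniformSphere (hd : 1 ≤ d) (hg : Measurable g)
    (hs : ∀ α, g (Real.pi - α) = g α) (e : UnitSphere d) :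
    ∫⁻ x, g (angle (normalVec b fun i => (x i : Space d)) e)
        ∂(Measure.pi fun _ : Fin d => uniformSphere d) =
      ENNReal.ofReal (omega d / omega (d + 1)) *
        ∫⁻ α in Ioo (0 : ℝ) Real.pi, ENNReal.ofReal (Real.sin α ^ (d - 1)) * g α := by
  have hLI := ae_linearIndependent (ρ := uniformSphere d) measurable_subtype_coe
    (fun _ => uniformSphere_submodule) (k := d) (by simp)
  calc
    _ = ∫⁻ e' : UnitSphere d, (∫⁻ x, g (angle (normalVec b fun i => (x i : Space d)) e')
          ∂(Measure.pi fun _ : Fin d => uniformSphere d)) ∂uniformSphere d := by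
      simp_rw [← lintegral_angle_normalVec_congr_pole b hg hs e, lintegral_const, measure_univ,
        mul_one]
    _ = ∫⁻ x, (∫⁻ e' : UnitSphere d, g (angle (normalVec b fun i => (x i : Space d)) e')
          ∂uniformSphere d) ∂(Measure.pi fun _ : Fin d => uniformSphere d) :=
      lintegral_lintegral_swap (by fun_prop)
    _ = ∫⁻ _, (ENNReal.ofReal (omega d / omega (d + 1)) * ∫⁻ α in Ioo (0 : ℝ) Real.pi,
          ENNReal.ofReal (Real.sin α ^ (d - 1)) * g α)
          ∂(Measure.pi fun _ : Fin d => uniformSphere d) :=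
      lintegral_congr_ae <| hLI.mono fun x hx =>
        lintegral_angle_uniformSphere hd (normalVec_ne_zero b hx) hg
    _ = _ := by simp

theorem lintegral_angle_normalVec (hd : 1 ≤ d) (hg : Measurable g)
    (hs : ∀ α, g (Real.pi - α) = g α) (e : UnitSphere d) :
    ∫⁻ x, g (angle (normalVec b fun i => (x i : Space d)) e)
        ∂(Measure.pi fun _ : Fin d => uniformHalfsphere e) =
      ENNReal.ofReal (omega d / omega (d + 1)) *
        ∫⁻ α in Ioo (0 : ℝ) Real.pi, ENNReal.ofReal (Real.sin α ^ (d - 1)) * g α := by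
  have hmp := measurePreserving_pi (fun _ : Fin d => uniformSphere d)
    (fun _ : Fin d => uniformHalfsphere e) (f := fun _ => foldTo e)
    fun _ => ⟨measurable_foldTo e, map_foldTo e⟩
  choose c hc hfold using exists_foldTo_eq_smul e
  rw [← lintegral_angle_normalVec_uniformSphere b hd hg hs e, ← hmp.lintegral_comp (by fun_prop)]
  refine lintegral_congr fun x => ?_
  simp_rw [hfold]
  rw [normalVec_smul, apply_angle_smul_left hs (Finset.prod_ne_zero_iff.2 fun i _ => hc _)]

end NormalAngle

section Cone

variable {ι κ V : Type*} [AddCommGroup V] [Module ℝ V] {x : ι → V} {I : Set ι}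
  {C F : PointedCone ℝ V}

/-- The vectors `x i` with `i ∈ I` lie on a hyperplane through `0`, and all others lie strictly on
one side of it. -/
def IsSupporting (x : ι → V) (I : Set ι) : Prop :=
  ∃ φ : V →ₗ[ℝ] ℝ, (∀ i ∈ I, φ (x i) = 0) ∧ ∀ i ∉ I, 0 < φ (x i)

theorem isSupporting_comp_equiv (σ : κ ≃ ι) : IsSupporting (x ∘ σ) (σ ⁻¹' I) ↔ IsSupporting x I :=
  exists_congr fun _ => and_congr (σ.forall_congr fun _ => .rfl) (σ.forall_congr fun _ => .rfl)

theorem isSupporting_iff_of_ker_eq_span {φ : V →ₗ[ℝ] ℝ}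
    (hφ : φ.ker = Submodule.span ℝ (x '' I)) :
    IsSupporting x I ↔ (∀ i ∉ I, 0 < φ (x i)) ∨ ∀ i ∉ I, φ (x i) < 0 := by
  have hzero : ∀ i ∈ I, φ (x i) = 0 := fun i hi =>
    hφ.ge (Submodule.subset_span (mem_image_of_mem x hi))
  constructor
  · rintro ⟨ψ, hψ0, hψ⟩
    have hker : φ.ker ≤ ψ.ker := by
      rw [hφ, Submodule.span_le]
      rintro _ ⟨i, hi, rfl⟩
      exact hψ0 i hi
    have hspan := mem_span_of_iInf_ker_le_ker (L := fun _ : Unit => φ) (iInf_const.trans_le hker)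
    rw [range_const, Submodule.mem_span_singleton] at hspan
    obtain ⟨c, rfl⟩ := hspan
    rcases le_or_gt 0 c with hc | hc
    · exact .inl fun i hi => pos_of_mul_pos_right (hψ i hi) hc
    · exact .inr fun i hi => neg_of_mul_pos_right (hψ i hi) hc.le
  · rintro (h | h)
    · exact ⟨φ, hzero, h⟩
    · exact ⟨-φ, fun i hi => neg_eq_zero.2 (hzero i hi), fun i hi => neg_pos.2 (h i hi)⟩

theorem span_hull (s : Set V) :
    Submodule.span ℝ (PointedCone.hull ℝ s : Set V) = Submodule.span ℝ s :=
  Submodule.span_span_of_tower {c : ℝ // 0 ≤ c} ℝ s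

theorem exists_add_mem_of_mem_span {y : V} (hy : y ∈ Submodule.span ℝ (F : Set V)) :
    ∃ f ∈ F, y + f ∈ F := by
  induction hy using Submodule.span_induction with
  | mem y hy => exact ⟨0, F.zero_mem, by simpa using hy⟩
  | zero => exact ⟨0, F.zero_mem, by simp⟩
  | add y z _ _ hy hz =>
    obtain ⟨f, hf, hyf⟩ := hy
    obtain ⟨g, hg, hzg⟩ := hz
    exact ⟨f + g, F.add_mem hf hg, by simpa only [add_add_add_comm] using F.add_mem hyf hzg⟩
  | smul c y _ hy =>
    obtain ⟨f, hf, hyf⟩ := hy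
    rcases le_or_gt 0 c with hc | hc
    · exact ⟨c • f, F.smul_mem hc hf, by simpa only [smul_add] using F.smul_mem hc hyf⟩
    · refine ⟨(-c) • (y + f), F.smul_mem (neg_nonneg.2 hc.le) hyf, ?_⟩
      simpa using F.smul_mem (neg_nonneg.2 hc.le) hf

theorem mem_of_add_mem_span (hF : F.IsFaceOf C) {a b : V} (ha : a ∈ C) (hb : b ∈ C)
    (hab : a + b ∈ Submodule.span ℝ (F : Set V)) : a ∈ F := by
  obtain ⟨f, hf, habf⟩ := exists_add_mem_of_mem_span hab
  exact hF.mem_of_add_mem_left ha (C.add_mem hb (hF.le hf)) (by rwa [← add_assoc])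

theorem mem_of_mem_span (hF : F.IsFaceOf C) {a : V} (ha : a ∈ C)
    (haF : a ∈ Submodule.span ℝ (F : Set V)) : a ∈ F :=
  mem_of_add_mem_span hF ha C.zero_mem (by rwa [add_zero])

theorem exists_ker_eq [FiniteDimensional ℝ V] {W : Submodule ℝ V}
    (hW : finrank ℝ W + 1 = finrank ℝ V) : ∃ φ : V →ₗ[ℝ] ℝ, φ.ker = W := by
  have hlt : W < ⊤ := Submodule.lt_top_of_finrank_lt_finrank (by lia)
  obtain ⟨φ, hφ, hle⟩ := W.exists_le_ker_of_lt_top hlt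
  have hker := Module.Dual.finrank_ker_add_one_of_ne_zero hφ
  exact ⟨φ, (Submodule.eq_of_le_of_finrank_eq hle (by lia)).symm⟩

/- If the hyperplane spanned by `F` separated two of the `x i`, then a positive combination of them
would lie in `F`. -/
theorem isSupporting_of_isFaceOf [FiniteDimensional ℝ V] (hF : F.IsFaceOf C) (hx : ∀ i, x i ∈ C)
    (hdim : finrank ℝ (Submodule.span ℝ (F : Set V)) + 1 = finrank ℝ V) :
    IsSupporting x {i | x i ∈ F} := by
  obtain ⟨φ, hφ⟩ := exists_ker_eq hdim
  have hφ0 {y : V} (hy : y ∈ F) : φ y = 0 := hφ.ge (Submodule.subset_span hy)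
  have hmem {y : V} (hy : φ y = 0) : y ∈ Submodule.span ℝ (F : Set V) := hφ.le hy
  have hne : ∀ i ∉ {i | x i ∈ F}, φ (x i) ≠ 0 := fun i hi h =>
    hi (mem_of_mem_span hF (hx i) (hmem h))
  by_cases hpos : ∀ i ∉ {i | x i ∈ F}, 0 < φ (x i)
  · exact ⟨φ, fun i hi => hφ0 hi, hpos⟩
  refine ⟨-φ, fun i hi => neg_eq_zero.2 (hφ0 hi), fun j hj => neg_pos.2 ?_⟩
  by_contra! hj0
  push Not at hpos
  obtain ⟨i, hi, hi0⟩ := hpos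
  have hj1 : 0 < φ (x j) := hj0.lt_of_ne' (hne j hj)
  have hcomb : φ (φ (x j) • x i + -φ (x i) • x j) = 0 := by
    rw [map_add, map_smul, map_smul, smul_eq_mul, smul_eq_mul]
    ring
  have hface := mem_of_add_mem_span hF (C.smul_mem hj0 (hx i))
    (C.smul_mem (neg_nonneg.2 hi0) (hx j)) (hmem hcomb)
  exact hi ((F.smul_mem_iff hj1).1 hface)

theorem eq_hull_of_isFaceOf [Finite ι] (hF : F.IsFaceOf (PointedCone.hull ℝ (range x))) :
    F = PointedCone.hull ℝ (x '' {i | x i ∈ F}) := by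
  have := Fintype.ofFinite ι
  refine le_antisymm (fun y hy => ?_) (Submodule.span_le.2 (image_subset_iff.2 fun i hi => hi))
  obtain ⟨c, rfl⟩ := (Submodule.mem_span_range_iff_exists_fun _).1 (hF.le hy)
  refine Submodule.sum_mem _ fun i _ => ?_
  rcases eq_or_ne (c i) 0 with h | h
  · simp [h]
  · have hi := hF.mem_of_sum_smul_mem (fun i => PointedCone.subset_hull (mem_range_self i))
      (fun i => (c i).2) hy i ((c i).2.lt_of_ne' (Subtype.coe_ne_coe.2 h))
    exact Submodule.smul_mem _ _ (PointedCone.subset_hull (mem_image_of_mem x hi))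

theorem map_eq_zero_of_mem_hull {s : Set V} {φ : V →ₗ[ℝ] ℝ} (hφ : ∀ y ∈ s, φ y = 0) {y : V}
    (hy : y ∈ PointedCone.hull ℝ s) : φ y = 0 :=
  (Submodule.span_le (p := φ.ker)).2 hφ (PointedCone.hull_le_span ℝ s hy)

theorem mem_hull_image_iff (hI : IsSupporting x I) (i : ι) :
    x i ∈ PointedCone.hull ℝ (x '' I) ↔ i ∈ I := by
  obtain ⟨φ, hφ0, hφ⟩ := hI
  refine ⟨fun h => ?_, fun h => PointedCone.subset_hull (mem_image_of_mem x h)⟩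
  by_contra hi
  exact (hφ i hi).ne' (map_eq_zero_of_mem_hull (forall_mem_image.2 hφ0) h)

theorem nonneg_and_mem_hull_image {φ : V →ₗ[ℝ] ℝ} (hφ0 : ∀ i ∈ I, φ (x i) = 0)
    (hφ : ∀ i ∉ I, 0 < φ (x i)) {y : V} (hy : y ∈ PointedCone.hull ℝ (range x)) :
    0 ≤ φ y ∧ (φ y = 0 → y ∈ PointedCone.hull ℝ (x '' I)) := by
  induction hy using Submodule.span_induction with
  | mem y hy =>
    obtain ⟨i, rfl⟩ := hy
    by_cases hi : i ∈ I
    · exact ⟨(hφ0 i hi).ge, fun _ => PointedCone.subset_hull (mem_image_of_mem x hi)⟩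
    · exact ⟨(hφ i hi).le, fun h => absurd h (hφ i hi).ne'⟩
  | zero => exact ⟨φ.map_zero.ge, fun _ => zero_mem _⟩
  | add y z _ _ hy hz =>
    rw [map_add]
    refine ⟨add_nonneg hy.1 hz.1, fun h => ?_⟩
    rw [add_eq_zero_iff_of_nonneg hy.1 hz.1] at h
    exact add_mem (hy.2 h.1) (hz.2 h.2)
  | smul c y _ hy =>
    have hmap : φ (c • y) = c * φ y := φ.map_smul (c : ℝ) y
    rw [hmap]
    refine ⟨mul_nonneg c.2 hy.1, fun h => ?_⟩
    rcases mul_eq_zero.1 h with hc | hy0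
    · rw [(Subtype.ext hc : c = 0), zero_smul]
      exact zero_mem _
    · exact Submodule.smul_mem _ c (hy.2 hy0)

theorem isFaceOf_hull_image (hI : IsSupporting x I) :
    (PointedCone.hull ℝ (x '' I)).IsFaceOf (PointedCone.hull ℝ (range x)) := by
  obtain ⟨φ, hφ0, hφ⟩ := hI
  refine ⟨Submodule.span_mono (image_subset_range x I), fun {u v a} hu hv ha h => ?_⟩
  have hu' := nonneg_and_mem_hull_image hφ0 hφ hu
  have hv' := nonneg_and_mem_hull_image hφ0 hφ hv
  have huv := map_eq_zero_of_mem_hull (forall_mem_image.2 hφ0) h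
  rw [map_add, map_smul, smul_eq_mul,
    add_eq_zero_iff_of_nonneg (mul_nonneg ha.le hu'.1) hv'.1] at huv
  exact hu'.2 ((mul_eq_zero_iff_left ha.ne').1 huv.1)

/-- Any `k` of the vectors, with `k` at most the dimension, are linearly independent. -/
def GeneralPosition (x : ι → V) : Prop :=
  ∀ s : Finset ι, s.card ≤ finrank ℝ V → LinearIndepOn ℝ x (s : Set ι)

theorem finrank_span_image (hx : GeneralPosition x) {s : Finset ι} (hs : s.card ≤ finrank ℝ V) :
    finrank ℝ (Submodule.span ℝ (x '' s)) = s.card := by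
  rw [image_eq_range]
  exact (finrank_span_eq_card (hx s hs).linearIndependent).trans (Fintype.card_coe s)

theorem card_eq_finrank_span_image [FiniteDimensional ℝ V] (hx : GeneralPosition x) {s : Finset ι}
    (hs : finrank ℝ (Submodule.span ℝ (x '' s)) < finrank ℝ V) :
    s.card = finrank ℝ (Submodule.span ℝ (x '' s)) := by
  rcases le_total s.card (finrank ℝ V) with h | h
  · exact (finrank_span_image hx h).symm
  · obtain ⟨t, hts, ht⟩ := Finset.exists_subset_card_eq h
    have hspan : finrank ℝ (Submodule.span ℝ (x '' t)) ≤ _ :=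
      Submodule.finrank_mono (Submodule.span_mono (image_mono (Finset.coe_subset.2 hts)))
    rw [finrank_span_image hx ht.le] at hspan
    lia

theorem facets_hull_range [FiniteDimensional ℝ V] [Finite ι] (hx : GeneralPosition x) :
    {F : PointedCone ℝ V | F.IsFaceOf (PointedCone.hull ℝ (range x)) ∧
        finrank ℝ (Submodule.span ℝ (F : Set V)) + 1 = finrank ℝ V} =
      (fun s : Finset ι => PointedCone.hull ℝ (x '' s)) ''
        {s | s.card + 1 = finrank ℝ V ∧ IsSupporting x s} := by
  have := Fintype.ofFinite ι
  ext F
  constructor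
  · rintro ⟨hF, hdim⟩
    have hsup := isSupporting_of_isFaceOf (x := x) hF
      (fun i => PointedCone.subset_hull (mem_range_self i)) hdim
    have hhull := eq_hull_of_isFaceOf hF
    lift {i | x i ∈ F} to Finset ι using toFinite _ with s
    rw [hhull, span_hull] at hdim
    refine ⟨s, ⟨?_, hsup⟩, hhull.symm⟩
    rw [card_eq_finrank_span_image hx (by lia), hdim]
  · rintro ⟨s, ⟨hs, hsup⟩, rfl⟩
    exact ⟨isFaceOf_hull_image hsup, by rw [span_hull, finrank_span_image hx (by lia), hs]⟩

end Cone

section Polytope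

variable {d n : ℕ}

theorem pos_convS (A : Set (UnitSphere d)) : pos (convS A) = pos A :=
  le_antisymm (Submodule.span_le.2 (image_subset_iff.2 fun _ hu => hu))
    (Submodule.span_mono (image_mono fun _ hu => PointedCone.subset_hull (mem_image_of_mem _ hu)))

theorem faceNumber_convS_range (hd : 1 ≤ d) {x : Fin n → UnitSphere d}
    (hx : GeneralPosition fun i => (x i : Space d)) :
    faceNumber (d - 1) (convS (range x)) =
      {s : Finset (Fin n) | s.card = d ∧ IsSupporting (fun i => (x i : Space d)) s}.ncard := by
  have hpos : pos (convS (range x)) = PointedCone.hull ℝ (range fun i => (x i : Space d)) := by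
    rw [pos_convS, pos, ← range_comp, Function.comp_def]
  have hfaces : faces (d - 1) (convS (range x)) =
      (fun s : Finset (Fin n) => {u : UnitSphere d |
        (u : Space d) ∈ PointedCone.hull ℝ ((fun i => (x i : Space d)) '' s)}) ''
        {s | s.card = d ∧ IsSupporting (fun i => (x i : Space d)) s} := by
    have hfacets := facets_hull_range hx
    simp only [finrank_euclideanSpace_fin, Nat.add_right_cancel_iff] at hfacets
    rw [← image_image (fun F : PointedCone ℝ (Space d) => {u : UnitSphere d | (u : Space d) ∈ F}),
      ← hfacets, faces, hpos, Nat.sub_add_cancel hd]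
    ext G
    simp only [mem_image, mem_ofPred_eq, and_assoc, eq_comm (a := G)]
  rw [faceNumber, hfaces]
  refine InjOn.ncard_image fun s hs t ht hst => Finset.ext fun i => ?_
  rw [← Finset.mem_coe, ← mem_hull_image_iff hs.2, ← Finset.mem_coe, ← mem_hull_image_iff ht.2]
  exact Set.ext_iff.1 hst (x i)

end Polytope

section OneSided

variable {E : Type*} [NormedAddCommGroup E] [InnerProductSpace ℝ E] {k m d : ℕ}

/-- All the points `y j` lie strictly on the same side of the hyperplane through `0` with normal
vector `w`. -/
def OneSided (w : E) {κ : Type*} (y : κ → E) : Prop :=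
  (∀ j, 0 < ⟪w, y j⟫) ∨ ∀ j, ⟪w, y j⟫ < 0

theorem isSupporting_range_inl_iff {κ : Type*} (b : OrthonormalBasis (Fin (k + 1)) ℝ E)
    {x : Fin k ⊕ κ → E} (hx : LinearIndependent ℝ (x ∘ Sum.inl)) :
    IsSupporting x (range Sum.inl) ↔ OneSided (normalVec b (x ∘ Sum.inl)) (x ∘ Sum.inr) := by
  have hker : (innerₛₗ ℝ (normalVec b (x ∘ Sum.inl))).ker =
      Submodule.span ℝ (x '' range Sum.inl) := by
    ext y
    rw [← range_comp]
    exact not_iff_not.1 (inner_normalVec_ne_zero_iff b hx)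
  rw [isSupporting_iff_of_ker_eq_span hker]
  simp [OneSided]

theorem measurableSet_oneSided {α : Type*} [MeasurableSpace α] [MeasurableSpace E] [BorelSpace E]
    [SecondCountableTopology E] {κ : Type*} [Countable κ] {w : α → E} (hw : Measurable w)
    {y : κ → α → E} (hy : ∀ j, Measurable (y j)) :
    MeasurableSet {a | OneSided (w a) fun j => y j a} :=
  .union
    (measurableSet_setOfPred.2 <| .forall fun j => measurable_const.lt (hw.inner (hy j)))
    (measurableSet_setOfPred.2 <| .forall fun j => (hw.inner (hy j)).lt measurable_const)

/-- The probability that `m` independent uniform points of the halfsphere lie strictly on the same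
side of a hyperplane through `0` whose normal vector makes the angle `α` with the pole. -/
def oneSidedProb (m : ℕ) (α : ℝ) : ℝ≥0∞ :=
  ENNReal.ofReal (1 - α / Real.pi) ^ m + ENNReal.ofReal (α / Real.pi) ^ m

theorem measurable_oneSidedProb (m : ℕ) : Measurable (oneSidedProb m) := by
  unfold oneSidedProb
  fun_prop

theorem one_sub_pi_sub_div_pi (α : ℝ) : 1 - (Real.pi - α) / Real.pi = α / Real.pi := by
  field_simp
  ring

theorem oneSidedProb_pi_sub (m : ℕ) (α : ℝ) : oneSidedProb m (Real.pi - α) = oneSidedProb m α := by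
  rw [oneSidedProb, one_sub_pi_sub_div_pi, sub_div, div_self Real.pi_ne_zero, add_comm,
    oneSidedProb]

theorem pi_oneSided (hd : 1 ≤ d) (hm : m ≠ 0) (e : UnitSphere d) {w : Space d} (hw : w ≠ 0) :
    Measure.pi (fun _ : Fin m => uniformHalfsphere e) {y | OneSided w fun j => (y j : Space d)} =
      oneSidedProb m (angle w e) := by
  have hunion : {y : Fin m → UnitSphere d | OneSided w fun j => (y j : Space d)} =
      (univ.pi fun _ => {u : UnitSphere d | 0 < ⟪w, (u : Space d)⟫}) ∪
        univ.pi fun _ => {u : UnitSphere d | 0 < ⟪-w, (u : Space d)⟫} := by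
    ext y
    simp [OneSided, Set.mem_pi]
  have hdisj : Disjoint (univ.pi fun _ : Fin m => {u : UnitSphere d | 0 < ⟪w, (u : Space d)⟫})
      (univ.pi fun _ => {u | 0 < ⟪-w, (u : Space d)⟫}) := by
    have : NeZero m := ⟨hm⟩
    refine disjoint_left.2 fun y hy hy' => ?_
    have hpos : 0 < ⟪w, (y 0 : Space d)⟫ := hy 0 trivial
    have hneg : 0 < ⟪-w, (y 0 : Space d)⟫ := hy' 0 trivial
    rw [inner_neg_left, neg_pos] at hneg
    exact lt_asymm hpos hneg
  rw [hunion, measure_union hdisj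
    (.univ_pi fun _ => measurableSet_lt measurable_const (by fun_prop)), Measure.pi_pi,
    Measure.pi_pi, uniformHalfsphere_inner_pos hd e hw,
    uniformHalfsphere_inner_pos hd e (neg_ne_zero.2 hw), angle_neg_left, one_sub_pi_sub_div_pi]
  simp [oneSidedProb]

theorem one_sub_div_pow_mul_sin_pow_nonneg (m k : ℕ) {α : ℝ} (h0 : 0 ≤ α) (hπ : α ≤ Real.pi) :
    0 ≤ (1 - α / Real.pi) ^ m * Real.sin α ^ k :=
  mul_nonneg (pow_nonneg (sub_nonneg.2 (div_le_one_of_le₀ hπ Real.pi_pos.le)) m)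
    (pow_nonneg (Real.sin_nonneg_of_nonneg_of_le_pi h0 hπ) k)

theorem lintegral_sin_pow_mul_oneSidedProb (k m : ℕ) :
    ∫⁻ α in Ioo (0 : ℝ) Real.pi, ENNReal.ofReal (Real.sin α ^ k) * oneSidedProb m α =
      ENNReal.ofReal (2 * ∫ α in (0 : ℝ)..Real.pi, (1 - α / Real.pi) ^ m * Real.sin α ^ k) := by
  let f (α : ℝ) : ℝ := (1 - α / Real.pi) ^ m * Real.sin α ^ k
  have hf : Continuous f := by fun_prop
  have hf' : Continuous fun α => f (Real.pi - α) := by fun_prop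
  have hnonneg {α : ℝ} (hα : α ∈ Ioo 0 Real.pi) : 0 ≤ f α ∧ 0 ≤ f (Real.pi - α) :=
    ⟨one_sub_div_pow_mul_sin_pow_nonneg m k hα.1.le hα.2.le,
      one_sub_div_pow_mul_sin_pow_nonneg m k (sub_nonneg.2 hα.2.le) (sub_le_self _ hα.1.le)⟩
  have hsym (α : ℝ) (hα : α ∈ Ioo 0 Real.pi) : ENNReal.ofReal (Real.sin α ^ k) * oneSidedProb m α =
      ENNReal.ofReal (f α + f (Real.pi - α)) := by
    have hsin := pow_nonneg (Real.sin_pos_of_mem_Ioo hα).le k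
    have h0 : 0 ≤ α / Real.pi := div_nonneg hα.1.le Real.pi_pos.le
    have h1 : 0 ≤ 1 - α / Real.pi := sub_nonneg.2 (div_le_one_of_le₀ hα.2.le Real.pi_pos.le)
    rw [ENNReal.ofReal_add (hnonneg hα).1 (hnonneg hα).2]
    simp only [f, one_sub_pi_sub_div_pi, Real.sin_pi_sub, ENNReal.ofReal_mul' hsin,
      ENNReal.ofReal_pow h0, ENNReal.ofReal_pow h1, oneSidedProb]
    ring
  have hinteg : IntegrableOn (fun α => f α + f (Real.pi - α)) (Ioo 0 Real.pi) :=
    (hf.add hf').integrableOn_Icc.mono_set Ioo_subset_Icc_self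
  have hreflect : ∫ α in (0 : ℝ)..Real.pi, f (Real.pi - α) = ∫ α in (0 : ℝ)..Real.pi, f α := by
    rw [intervalIntegral.integral_comp_sub_left, sub_self, sub_zero]
  rw [setLIntegral_congr_fun measurableSet_Ioo hsym, ← ofReal_integral_eq_lintegral_ofReal hinteg
      ((ae_restrict_mem measurableSet_Ioo).mono fun α hα =>
        add_nonneg (hnonneg hα).1 (hnonneg hα).2),
    ← integral_Ioc_eq_integral_Ioo, ← intervalIntegral.integral_of_le Real.pi_pos.le,
    intervalIntegral.integral_add (hf.intervalIntegrable _ _) (hf'.intervalIntegrable _ _),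
    hreflect, two_mul]

end OneSided

section Sample

variable {ι κ : Type*} {d m : ℕ}

/-- The configurations of points of the sphere in which the points with index in `I` lie on a
hyperplane through `0` and all others lie strictly on one side of it. -/
def supportingConfigs (d : ℕ) (I : Set ι) : Set (ι → UnitSphere d) :=
  {x | IsSupporting (fun i => (x i : Space d)) I}

theorem preimage_supportingConfigs (σ : κ ≃ ι) (I : Set ι) :
    (fun x => x ∘ σ) ⁻¹' supportingConfigs d (σ ⁻¹' I) = supportingConfigs d I :=
  ext fun x => isSupporting_comp_equiv (x := fun i => (x i : Space d)) σ

variable [Fintype ι] [Fintype κ]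

theorem measurePreserving_comp_injective {α : Type*} [MeasurableSpace α] (ρ : Measure α)
    [IsProbabilityMeasure ρ] {g : κ → ι} (hg : g.Injective) :
    MeasurePreserving (fun x : ι → α => x ∘ g) (Measure.pi fun _ => ρ) (Measure.pi fun _ => ρ) := by
  have hindep : iIndepFun (fun (i : ι) (x : ι → α) => x i) (Measure.pi fun _ => ρ) :=
    iIndepFun_pi (X := fun _ => id) fun _ => aemeasurable_id
  have hlaw := (hindep.precomp hg).hasLaw_pi fun i => (measurePreserving_eval _ (g i)).hasLaw
  exact hlaw.measurePreserving (by fun_prop)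

theorem ae_generalPosition {E : Type*} [NormedAddCommGroup E] [InnerProductSpace ℝ E]
    [FiniteDimensional ℝ E] [MeasurableSpace E] [BorelSpace E]
    {α : Type*} [MeasurableSpace α] {ρ : Measure α} [IsProbabilityMeasure ρ]
    {f : α → E} (hf : Measurable f) (hρ : ∀ V : Submodule ℝ E, V ≠ ⊤ → ρ (f ⁻¹' V) = 0) :
    ∀ᵐ x ∂Measure.pi fun _ : ι => ρ, GeneralPosition (f ∘ x) := by
  refine ae_all_iff.2 fun s => ?_
  rw [eventually_imp_distrib_left]
  intro hs
  have hmp := measurePreserving_comp_injective ρ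
    (Subtype.val_injective.comp s.equivFin.symm.injective)
  filter_upwards [hmp.quasiMeasurePreserving.ae (ae_linearIndependent hf hρ hs)] with x hx
  exact (linearIndependent_equiv s.equivFin.symm).1 hx

theorem ae_generalPosition_uniformHalfsphere (e : UnitSphere d) :
    ∀ᵐ x ∂Measure.pi fun _ : ι => uniformHalfsphere e,
      GeneralPosition fun i => (x i : Space d) :=
  ae_generalPosition measurable_subtype_coe fun _ => uniformHalfsphere_submodule e

/-- The probability that `d` given points of a uniform sample of `d + m` points of the halfsphere
lie on a supporting hyperplane of the sample. -/
def facetProb (d m : ℕ) : ℝ :=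
  2 * omega d / omega (d + 1) *
    ∫ α in (0 : ℝ)..Real.pi, (1 - α / Real.pi) ^ m * Real.sin α ^ (d - 1)

theorem facetProb_nonneg (hd : 1 ≤ d) (m : ℕ) : 0 ≤ facetProb d m := by
  have hω := omega_pos hd
  have hω' := omega_pos d.succ_pos
  exact mul_nonneg (by positivity) <| intervalIntegral.integral_nonneg Real.pi_pos.le fun α hα =>
    one_sub_div_pow_mul_sin_pow_nonneg m (d - 1) hα.1 hα.2

theorem prod_oneSided (hd : 1 ≤ d) (hm : m ≠ 0) (e : UnitSphere d)
    (b : OrthonormalBasis (Fin (d + 1)) ℝ (Space d)) :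
    ((Measure.pi fun _ : Fin d => uniformHalfsphere e).prod
      (Measure.pi fun _ : Fin m => uniformHalfsphere e))
      {p | OneSided (normalVec b fun i => (p.1 i : Space d)) fun j => (p.2 j : Space d)} =
      ENNReal.ofReal (facetProb d m) := by
  have hω := omega_pos hd
  have hω' := omega_pos d.succ_pos
  have hLI := ae_linearIndependent measurable_subtype_coe
    (fun _ => uniformHalfsphere_submodule e) (k := d) (by simp)
  have hmeas : MeasurableSet {p : (Fin d → UnitSphere d) × (Fin m → UnitSphere d) |
      OneSided (normalVec b fun i => (p.1 i : Space d)) fun j => (p.2 j : Space d)} :=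
    measurableSet_oneSided (by fun_prop) (by fun_prop)
  have hslice : ∀ᵐ x ∂Measure.pi fun _ : Fin d => uniformHalfsphere e,
      Measure.pi (fun _ : Fin m => uniformHalfsphere e)
        {y | OneSided (normalVec b fun i => (x i : Space d)) fun j => (y j : Space d)} =
      oneSidedProb m (angle (normalVec b fun i => (x i : Space d)) e) := by
    filter_upwards [hLI] with x hx
    exact pi_oneSided hd hm e (normalVec_ne_zero b hx)
  rw [Measure.prod_apply hmeas]
  simp only [preimage_ofPred_eq]
  rw [lintegral_congr_ae hslice, facetProb, mul_div_assoc, mul_comm (2 : ℝ), mul_assoc,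
    ENNReal.ofReal_mul (by positivity), ← lintegral_sin_pow_mul_oneSidedProb]
  exact lintegral_angle_normalVec b hd (measurable_oneSidedProb m) (oneSidedProb_pi_sub m) e

theorem supportingConfigs_range_inl_ae_eq (e : UnitSphere d)
    (b : OrthonormalBasis (Fin (d + 1)) ℝ (Space d)) :
    supportingConfigs d (range (Sum.inl : Fin d → Fin d ⊕ Fin m))
      =ᵐ[Measure.pi fun _ => uniformHalfsphere e]
      {x | OneSided (normalVec b fun i => (x (.inl i) : Space d))
        fun j => (x (.inr j) : Space d)} := by
  have hLI := ae_linearIndependent measurable_subtype_coe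
    (fun _ => uniformHalfsphere_submodule e) (k := d) (by simp)
  have hmp := measurePreserving_comp_injective (uniformHalfsphere e)
    (Sum.inl_injective (α := Fin d) (β := Fin m))
  filter_upwards [hmp.quasiMeasurePreserving.ae hLI] with x hx
  exact propext (isSupporting_range_inl_iff b hx)

end Sample

section Expectation

variable {d m n : ℕ}

theorem pi_supportingConfigs_range_inl (hd : 1 ≤ d) (hm : m ≠ 0) (e : UnitSphere d) :
    NullMeasurableSet (supportingConfigs d (range (Sum.inl : Fin d → Fin d ⊕ Fin m)))
      (Measure.pi fun _ => uniformHalfsphere e) ∧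
    Measure.pi (fun _ => uniformHalfsphere e)
        (supportingConfigs d (range (Sum.inl : Fin d → Fin d ⊕ Fin m))) =
      ENNReal.ofReal (facetProb d m) := by
  let b := EuclideanSpace.basisFun (Fin (d + 1)) ℝ
  have hae := supportingConfigs_range_inl_ae_eq (m := m) e b
  have hmp := measurePreserving_sumPiEquivProdPi fun _ : Fin d ⊕ Fin m => uniformHalfsphere e
  have hmeas : MeasurableSet {p : (Fin d → UnitSphere d) × (Fin m → UnitSphere d) |
      OneSided (normalVec b fun i => (p.1 i : Space d)) fun j => (p.2 j : Space d)} :=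
    measurableSet_oneSided (by fun_prop) (by fun_prop)
  refine ⟨(hmp.measurable hmeas).nullMeasurableSet.congr hae.symm, ?_⟩
  rw [measure_congr hae, ← prod_oneSided hd hm e b]
  exact hmp.measure_preimage hmeas.nullMeasurableSet

theorem pi_supportingConfigs (hd : 1 ≤ d) (hn : d + 1 ≤ n) (e : UnitSphere d)
    {I : Finset (Fin n)} (hI : I.card = d) :
    NullMeasurableSet (supportingConfigs d (I : Set (Fin n)))
      (Measure.pi fun _ => uniformHalfsphere e) ∧
    (Measure.pi fun _ => uniformHalfsphere e).real (supportingConfigs d (I : Set (Fin n))) =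
      facetProb d (n - d) := by
  have hIc : Iᶜ.card = n - d := by rw [Finset.card_compl, Fintype.card_fin, hI]
  let σ := finSumEquivOfFinset hI hIc
  have hσ : σ ⁻¹' I = range Sum.inl := by
    ext (i | i)
    · simp [σ, Finset.orderEmbOfFin_mem]
    · simpa [σ] using Finset.mem_compl.1 (Finset.orderEmbOfFin_mem Iᶜ hIc i)
  have hmp := measurePreserving_comp_injective (uniformHalfsphere e) σ.injective
  obtain ⟨hnull, hprob⟩ := pi_supportingConfigs_range_inl hd (Nat.sub_ne_zero_of_lt hn) e
  rw [← preimage_supportingConfigs σ, hσ, measureReal_def, hmp.measure_preimage hnull, hprob,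
    ENNReal.toReal_ofReal (facetProb_nonneg hd _)]
  exact ⟨hnull.preimage hmp.quasiMeasurePreserving, rfl⟩

open Classical in
theorem faceNumber_convS_range_eq_sum (hd : 1 ≤ d) {x : Fin n → UnitSphere d}
    (hx : GeneralPosition fun i => (x i : Space d)) :
    (faceNumber (d - 1) (convS (range x)) : ℝ) =
      ∑ I ∈ (Finset.univ : Finset (Fin n)).powersetCard d,
        (supportingConfigs d (I : Set (Fin n))).indicator 1 x := by
  have hfilter : {I : Finset (Fin n) | I.card = d ∧ IsSupporting (fun i => (x i : Space d)) I} =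
      ((Finset.univ.powersetCard d).filter fun I : Finset (Fin n) =>
        IsSupporting (fun i => (x i : Space d)) I : Finset (Finset (Fin n))) := by
    ext I
    simp
  rw [faceNumber_convS_range hd hx, hfilter, ncard_coe_finset, Finset.card_filter, Nat.cast_sum]
  simp [indicator_apply, supportingConfigs]

theorem integral_pi_faceNumber (hd : 1 ≤ d) (hn : d + 1 ≤ n) (e : UnitSphere d) :
    Integrable (fun x : Fin n → UnitSphere d => (faceNumber (d - 1) (convS (range x)) : ℝ))
      (Measure.pi fun _ => uniformHalfsphere e) ∧
    ∫ x : Fin n → UnitSphere d, (faceNumber (d - 1) (convS (range x)) : ℝ)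
        ∂(Measure.pi fun _ => uniformHalfsphere e) =
      n.choose d * facetProb d (n - d) := by
  have hsum : (fun x : Fin n → UnitSphere d => (faceNumber (d - 1) (convS (range x)) : ℝ))
      =ᵐ[Measure.pi fun _ => uniformHalfsphere e] fun x =>
        ∑ I ∈ (Finset.univ : Finset (Fin n)).powersetCard d,
          (supportingConfigs d (I : Set (Fin n))).indicator 1 x :=
    (ae_generalPosition_uniformHalfsphere e).mono fun x hx => faceNumber_convS_range_eq_sum hd hx
  have hevent (I) (hI : I ∈ (Finset.univ : Finset (Fin n)).powersetCard d) :=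
    pi_supportingConfigs hd hn e (Finset.mem_powersetCard.1 hI).2
  have hinteg (I) (hI : I ∈ (Finset.univ : Finset (Fin n)).powersetCard d) :
      Integrable ((supportingConfigs d (I : Set (Fin n))).indicator
        (1 : (Fin n → UnitSphere d) → ℝ)) (Measure.pi fun _ => uniformHalfsphere e) :=
    (integrable_const (1 : ℝ)).indicator₀ (hevent I hI).1
  have hval (I) (hI : I ∈ (Finset.univ : Finset (Fin n)).powersetCard d) :
      ∫ x, (supportingConfigs d (I : Set (Fin n))).indicator (1 : (Fin n → UnitSphere d) → ℝ) x
        ∂(Measure.pi fun _ => uniformHalfsphere e) = facetProb d (n - d) := by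
    rw [integral_indicator₀ (hevent I hI).1]
    simpa using (hevent I hI).2
  refine ⟨(integrable_finsetSum _ hinteg).congr hsum.symm, ?_⟩
  rw [integral_congr_ae hsum, integral_finsetSum _ hinteg, Finset.sum_congr rfl hval,
    Finset.sum_const, Finset.card_powersetCard, Finset.card_fin, nsmul_eq_mul]

theorem integral_faceNumber (hd : 1 ≤ d) (hn : d + 1 ≤ n) (e : UnitSphere d)
    {Ω : Type*} [MeasurableSpace Ω] {Q : Measure Ω}
    {X : Fin n → Ω → UnitSphere d} (hX : IsUniformSample e Q X) :
    Integrable (fun ω => (faceNumber (d - 1) (randomPolytope X ω) : ℝ)) Q ∧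
      ∫ ω, (faceNumber (d - 1) (randomPolytope X ω) : ℝ) ∂Q =
        n.choose d * facetProb d (n - d) := by
  have hlaw := hX.indep.hasLaw_pi hX.law
  obtain ⟨hinteg, hval⟩ := integral_pi_faceNumber hd hn e
  rw [← hlaw.map_eq] at hinteg
  refine ⟨hinteg.comp_aemeasurable hlaw.aemeasurable, ?_⟩
  rw [← hval, ← hlaw.integral_comp (hlaw.map_eq ▸ hinteg.aestronglyMeasurable)]
  rfl

end Expectation

section Asymptotics

variable {d : ℕ}

theorem mul_one_sub_div_pi_sq_le_sin {x : ℝ} (h0 : 0 ≤ x) (hπ : x ≤ Real.pi) :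
    x * (1 - x / Real.pi) ^ 2 ≤ Real.sin x := by
  obtain rfl | hlt := hπ.eq_or_lt
  · simp
  have hcos_pos : 0 < Real.cos (x / 2) := Real.cos_pos_of_mem_Ioo ⟨by linarith, by linarith⟩
  have hsin : x / 2 * Real.cos (x / 2) ≤ Real.sin (x / 2) := by
    rw [← le_div_iff₀ hcos_pos, ← Real.tan_eq_sin_div_cos]
    exact Real.le_tan (by linarith) (by linarith)
  have hcos : 1 - x / Real.pi ≤ Real.cos (x / 2) := by
    convert! Real.one_sub_mul_le_cos (x := x / 2) (by linarith) (by linarith) using 1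
    field_simp
  have hnonneg : 0 ≤ 1 - x / Real.pi := sub_nonneg.2 (div_le_one_of_le₀ hπ Real.pi_pos.le)
  calc x * (1 - x / Real.pi) ^ 2 ≤ x * Real.cos (x / 2) ^ 2 := by gcongr
    _ = 2 * (x / 2 * Real.cos (x / 2)) * Real.cos (x / 2) := by ring
    _ ≤ 2 * Real.sin (x / 2) * Real.cos (x / 2) := by gcongr
    _ = Real.sin x := by rw [← Real.sin_two_mul, mul_div_cancel₀ x two_ne_zero]

theorem integral_one_sub_div_pow_mul_pow_succ {b : ℝ} (hb : b ≠ 0) (m k : ℕ) :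
    (m + 1) * ∫ x in (0 : ℝ)..b, (1 - x / b) ^ m * x ^ (k + 1) =
      b * (k + 1) * ∫ x in (0 : ℝ)..b, (1 - x / b) ^ (m + 1) * x ^ k := by
  have hderiv (x : ℝ) : HasDerivAt (fun x => (1 - x / b) ^ (m + 1) * x ^ (k + 1))
      ((k + 1) * ((1 - x / b) ^ (m + 1) * x ^ k) -
        (m + 1) / b * ((1 - x / b) ^ m * x ^ (k + 1))) x := by
    have h := ((((hasDerivAt_id x).div_const b).const_sub 1).pow (m + 1)).mul
      ((hasDerivAt_id x).pow (k + 1))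
    convert! h using 1
    simp
    ring
  have hftc := intervalIntegral.integral_eq_sub_of_hasDerivAt (a := 0) (b := b)
    (fun x _ => hderiv x) (Continuous.intervalIntegrable (by fun_prop) _ _)
  rw [intervalIntegral.integral_sub (Continuous.intervalIntegrable (by fun_prop) _ _)
    (Continuous.intervalIntegrable (by fun_prop) _ _), intervalIntegral.integral_const_mul,
    intervalIntegral.integral_const_mul, div_self hb] at hftc
  simp only [sub_self, ne_eq, Nat.succ_ne_zero, not_false_eq_true, zero_pow, zero_mul, mul_zero,
    sub_eq_zero] at hftc
  rw [mul_assoc, hftc]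
  field_simp

theorem choose_mul_integral_one_sub_div_pow_mul_pow {b : ℝ} (hb : b ≠ 0) (m k : ℕ) :
    ((m + k + 1).choose (k + 1) : ℝ) * ∫ x in (0 : ℝ)..b, (1 - x / b) ^ m * x ^ k =
      b ^ (k + 1) / (k + 1) := by
  induction k generalizing m with
  | zero =>
    have h := intervalIntegral.integral_comp_sub_div (a := 0) (b := b) (fun x => x ^ m) hb 1
    simp only [div_self hb, sub_self, zero_div, sub_zero, integral_pow, smul_eq_mul] at h
    simp only [pow_zero, mul_one, h]
    field_simp
    simp
  | succ k ih =>
    have hchoose : ((m + (k + 1) + 1).choose (k + 2) : ℝ) * (k + 2) =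
        (m + 1 + k + 1).choose (k + 1) * (m + 1) := by
      have h := Nat.choose_succ_right_eq (m + (k + 1) + 1) (k + 1)
      rw [show m + (k + 1) + 1 - (k + 1) = m + 1 by lia] at h
      rw [show m + 1 + k + 1 = m + (k + 1) + 1 by lia]
      exact_mod_cast h
    have hstep := integral_one_sub_div_pow_mul_pow_succ hb m k
    have hprev := (eq_div_iff (by positivity)).1 (ih (m + 1))
    rw [eq_div_iff (by positivity)]
    push_cast at hprev ⊢
    linear_combination (∫ x in (0 : ℝ)..b, (1 - x / b) ^ m * x ^ (k + 1)) * hchoose +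
      ((m + 1 + k + 1).choose (k + 1) : ℝ) * hstep + b * hprev

theorem tendsto_choose_div_choose_add (k j : ℕ) :
    Tendsto (fun n : ℕ => (n.choose k : ℝ) / (n + j).choose k) atTop (𝓝 1) := by
  have hequiv := (isEquivalent_choose k).div
    ((isEquivalent_choose k).comp_tendsto (tendsto_add_atTop_nat j))
  refine hequiv.symm.tendsto_nhds ?_
  have hratio := (tendsto_natCast_div_add_atTop (j : ℝ)).pow k
  rw [one_pow] at hratio
  refine hratio.congr fun n => ?_
  simp [div_pow, Nat.factorial_ne_zero, div_div_div_cancel_right₀]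

theorem integral_one_sub_div_pow_mul_sin_pow_le (m k : ℕ) :
    (∫ α in (0 : ℝ)..Real.pi, (1 - α / Real.pi) ^ m * Real.sin α ^ k) ≤
      ∫ α in (0 : ℝ)..Real.pi, (1 - α / Real.pi) ^ m * α ^ k := by
  refine intervalIntegral.integral_mono_on Real.pi_pos.le
    (Continuous.intervalIntegrable (by fun_prop) _ _)
    (Continuous.intervalIntegrable (by fun_prop) _ _) fun α ⟨h0, hπ⟩ => ?_
  have hnonneg : 0 ≤ 1 - α / Real.pi := sub_nonneg.2 (div_le_one_of_le₀ hπ Real.pi_pos.le)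
  have hsin := Real.sin_nonneg_of_nonneg_of_le_pi h0 hπ
  gcongr
  exact Real.sin_le h0

theorem le_integral_one_sub_div_pow_mul_sin_pow (m k : ℕ) :
    (∫ α in (0 : ℝ)..Real.pi, (1 - α / Real.pi) ^ (m + 2 * k) * α ^ k) ≤
      ∫ α in (0 : ℝ)..Real.pi, (1 - α / Real.pi) ^ m * Real.sin α ^ k := by
  refine intervalIntegral.integral_mono_on Real.pi_pos.le
    (Continuous.intervalIntegrable (by fun_prop) _ _)
    (Continuous.intervalIntegrable (by fun_prop) _ _) fun α ⟨h0, hπ⟩ => ?_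
  have hnonneg : 0 ≤ 1 - α / Real.pi := sub_nonneg.2 (div_le_one_of_le₀ hπ Real.pi_pos.le)
  rw [pow_add, pow_mul, mul_assoc, ← mul_pow, mul_comm _ α]
  gcongr
  exact mul_one_sub_div_pi_sq_le_sin h0 hπ

theorem tendsto_choose_mul_integral_sin_pow (k : ℕ) :
    Tendsto (fun m : ℕ => ((m + k + 1).choose (k + 1) : ℝ) *
      ∫ α in (0 : ℝ)..Real.pi, (1 - α / Real.pi) ^ m * Real.sin α ^ k) atTop
      (𝓝 (Real.pi ^ (k + 1) / (k + 1))) := by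
  have hbeta := choose_mul_integral_one_sub_div_pow_mul_pow Real.pi_ne_zero
  have hlim := ((tendsto_choose_div_choose_add (k + 1) (2 * k)).comp
    (tendsto_add_atTop_nat (k + 1))).mul_const (Real.pi ^ (k + 1) / (k + 1))
  rw [one_mul] at hlim
  refine tendsto_of_tendsto_of_tendsto_of_le_of_le hlim tendsto_const_nhds (fun m => ?_)
    fun m => ?_
  · have hpos : (0 : ℝ) < (m + 2 * k + k + 1).choose (k + 1) :=
      mod_cast Nat.choose_pos (by lia)
    refine le_trans (le_of_eq ?_) (mul_le_mul_of_nonneg_left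
      (le_integral_one_sub_div_pow_mul_sin_pow m k) (Nat.cast_nonneg _))
    rw [← hbeta (m + 2 * k) k]
    simp only [Function.comp_apply]
    rw [show m + (k + 1) + 2 * k = m + 2 * k + k + 1 by lia]
    rw [← mul_assoc, div_mul_cancel₀ _ hpos.ne', add_assoc]
  · rw [← hbeta m k]
    exact mul_le_mul_of_nonneg_left (integral_one_sub_div_pow_mul_sin_pow_le m k)
      (Nat.cast_nonneg _)

theorem two_mul_omega_div_omega_succ_mul (hd : 1 ≤ d) :
    2 * omega d / omega (d + 1) * (Real.pi ^ d / d) =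
      ((2 : ℝ) ^ d)⁻¹ * (d.factorial : ℝ) * kappa d ^ 2 := by
  have hd0 : (0 : ℝ) < d := mod_cast hd
  have hfac : (d.factorial : ℝ) = d * Real.Gamma d := by
    rw [← Real.Gamma_add_one hd0.ne', Real.Gamma_nat_eq_factorial]
  have hpi : Real.pi ^ ((d : ℝ) / 2) * Real.pi ^ ((d : ℝ) / 2) = Real.pi ^ d := by
    rw [← Real.rpow_add Real.pi_pos, add_halves, Real.rpow_natCast]
  have hpi_succ : Real.pi ^ ((d : ℝ) / 2 + 1 / 2) = Real.pi ^ ((d : ℝ) / 2) * √Real.pi := by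
    rw [Real.sqrt_eq_rpow, ← Real.rpow_add Real.pi_pos]
  have hduplication : Real.Gamma d = Real.Gamma ((d : ℝ) / 2) *
      Real.Gamma ((d : ℝ) / 2 + 1 / 2) * 2 ^ d / (2 * √Real.pi) := by
    rw [Real.Gamma_mul_Gamma_add_half, mul_div_cancel₀ _ two_ne_zero, Real.rpow_sub two_pos,
      Real.rpow_one, Real.rpow_natCast]
    field_simp
  have hsqrt : √Real.pi ≠ 0 := by positivity
  have hpow : Real.pi ^ ((d : ℝ) / 2) ≠ 0 := by positivity
  rw [kappa, omega, omega, Nat.cast_succ, add_div, hpi_succ, hfac, hduplication, ← hpi]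
  field_simp

theorem tendsto_choose_mul_facetProb (hd : 1 ≤ d) :
    Tendsto (fun n : ℕ => n.choose d * facetProb d (n - d)) atTop
      (𝓝 (((2 : ℝ) ^ d)⁻¹ * (d.factorial : ℝ) * kappa d ^ 2)) := by
  obtain ⟨k, rfl⟩ := Nat.exists_eq_add_of_le' hd
  rw [← two_mul_omega_div_omega_succ_mul hd, ← tendsto_add_atTop_iff_nat (k + 1), Nat.cast_succ]
  refine ((tendsto_choose_mul_integral_sin_pow k).const_mul _).congr fun m => ?_
  rw [facetProb, Nat.add_sub_cancel, Nat.add_sub_cancel, mul_left_comm, add_assoc m]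

end Asymptotics

end HalfspherePolytope

end

theorem theoremT1_general (d : ℕ) (hd : 1 ≤ d) (e : HalfspherePolytope.UnitSphere d) :
    (∀ (n : ℕ), d + 1 ≤ n →
      ∀ (Ω : Type*) [MeasurableSpace Ω] (Q : Measure Ω)
        (X : Fin n → Ω → HalfspherePolytope.UnitSphere d),
        HalfspherePolytope.IsUniformSample e Q X →
        Integrable (fun ω => (HalfspherePolytope.faceNumber (d - 1)
          (HalfspherePolytope.randomPolytope X ω) : ℝ)) Q ∧
        ∫ ω, (HalfspherePolytope.faceNumber (d - 1)
            (HalfspherePolytope.randomPolytope X ω) : ℝ) ∂Q =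
          2 * HalfspherePolytope.omega d / HalfspherePolytope.omega (d + 1) * (n.choose d : ℝ) *
            ∫ α in (0 : ℝ)..Real.pi,
              (1 - α / Real.pi) ^ (n - d) * Real.sin α ^ (d - 1)) ∧
    (∀ (Ω : ℕ → Type*) [∀ n, MeasurableSpace (Ω n)] (Q : ∀ n, Measure (Ω n))
        (X : ∀ n, Fin n → Ω n → HalfspherePolytope.UnitSphere d),
        (∀ n, d + 1 ≤ n → HalfspherePolytope.IsUniformSample e (Q n) (X n)) →
        Filter.Tendsto
          (fun n => ∫ ω, (HalfspherePolytope.faceNumber (d - 1)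
            (HalfspherePolytope.randomPolytope (X n) ω) : ℝ) ∂(Q n))
          Filter.atTop
          (nhds (((2 : ℝ) ^ d)⁻¹ * (d.factorial : ℝ) * HalfspherePolytope.kappa d ^ 2))) := by
  refine ⟨fun n hn Ω _ Q X hX => ?_, fun Ω _ Q X hX => ?_⟩
  · obtain ⟨hinteg, hval⟩ := HalfspherePolytope.integral_faceNumber hd hn e hX
    refine ⟨hinteg, hval.trans ?_⟩
    rw [HalfspherePolytope.facetProb]
    ring
  · refine (HalfspherePolytope.tendsto_choose_mul_facetProb hd).congr' ?_
    filter_upwards [Filter.eventually_ge_atTop (d + 1)] with n hn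
    exact (HalfspherePolytope.integral_faceNumber hd hn e (hX n hn)).2.symm

theorem theoremT1 (d : ℕ) (hd : 2 ≤ d) (e : HalfspherePolytope.UnitSphere d) :
    (∀ (n : ℕ), d + 1 ≤ n →
      ∀ (Ω : Type*) [MeasurableSpace Ω] (Q : Measure Ω) [IsProbabilityMeasure Q]
        (X : Fin n → Ω → HalfspherePolytope.UnitSphere d),
        HalfspherePolytope.IsUniformSample e Q X →
        Integrable (fun ω => (HalfspherePolytope.faceNumber (d - 1)
          (HalfspherePolytope.randomPolytope X ω) : ℝ)) Q ∧
        ∫ ω, (HalfspherePolytope.faceNumber (d - 1)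
            (HalfspherePolytope.randomPolytope X ω) : ℝ) ∂Q =
          2 * HalfspherePolytope.omega d / HalfspherePolytope.omega (d + 1) * (n.choose d : ℝ) *
            ∫ α in (0 : ℝ)..Real.pi,
              (1 - α / Real.pi) ^ (n - d) * Real.sin α ^ (d - 1)) ∧
    (∀ (Ω : ℕ → Type*) [∀ n, MeasurableSpace (Ω n)] (Q : ∀ n, Measure (Ω n))
        [∀ n, IsProbabilityMeasure (Q n)]
        (X : ∀ n, Fin n → Ω n → HalfspherePolytope.UnitSphere d),
        (∀ n, d + 1 ≤ n → HalfspherePolytope.IsUniformSample e (Q n) (X n)) →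
        Filter.Tendsto
          (fun n => ∫ ω, (HalfspherePolytope.faceNumber (d - 1)
            (HalfspherePolytope.randomPolytope (X n) ω) : ℝ) ∂(Q n))
          Filter.atTop
          (nhds (((2 : ℝ) ^ d)⁻¹ * (d.factorial : ℝ) * HalfspherePolytope.kappa d ^ 2))) :=
  have h := theoremT1_general d (one_le_two.trans hd) e
  ⟨fun n hn Ω _ Q _ => h.1 n hn Ω Q, fun Ω _ Q _ => h.2 Ω Q⟩
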